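/- Let $n$ be a natural number, let $N_n$ be the group of real unipotent upper triangular $n\times n$ matrices, and let $N_n^+\subset N_n$ be the set of totally positive matrices, i.e. of those $M\in N_n$ for which every minor that does not vanish identically on $N_n$ is positive. For $x>0$ put $$ l(x)=\frac{6}{\pi^2}\,L\Bigl(\frac{x}{1+x}\Bigr),\qquad L(u)=\mathrm{Li}_2(u)+\tfrac12\log u\,\log(1-u),\qquad \mathrm{Li}_2(u)=\sum_{k\ge1}\frac{u^k}{k^2}\qquad(0<u<1). $$ For $I,J\subset\{1,\dots,n\}$ let $\Delta_I(M)$ be the minor of $M$ with rows $I$ and the last $|I|$ columns, and $\Delta^J(M)$ the minor with the first $|J|$ rows and columns $J$ ($\Delta_\emptyset=\Delta^\emptyset=1$). Write $[a,b]=\{i\in\mathbb N: a\le i\le b\}$, and for $1\le a<b<c\le n$ set $$ Y_{abc}=\frac{\Delta_{[a,b-1]\cup[c+1,n]}\,\Delta_{[a+1,b]\cup[c,n]}}{\Delta_{[a,b]\cup[c+1,n]}\,\Delta_{[a+1,b-1]\cup[c,n]}},\qquad Y^{abc}=\frac{\Delta^{[a,b]\cup[c+1,n]}\,\Delta^{[a+1,b-1]\cup[c,n]}}{\Delta^{[a,b-1]\cup[c+1,n]}\,\Delta^{[a+1,b]\cup[c,n]}}.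 $$ Let $P$ be the permutation matrix $P_{ij}=\delta_{i+j,n+1}$. For $M\in N_n^+$ let $M',M''\in N_n$ be the unique unipotent upper triangular matrices such that $PMP=M'\,P\,D\,M''$ for some diagonal matrix $D$. Let $T_n=\{(a,b,c)\in\mathbb N^3: 1\le a<b<c\le n\}$. Then, for every $M\in N_n^+$, $$ \sum_{(a,b,c)\in T_n} l\bigl(Y_{abc}(M)\bigr)+\sum_{(a,b,c)\in T_n} l\bigl(Y_{abc}(M')\bigr)=\frac{n(n-1)(n-2)}{6}, $$ $$ \sum_{(a,b,c)\in T_n} l\bigl(Y^{abc}(M)\bigr)+\sum_{(a,b,c)\in T_n} l\bigl(Y^{abc}(M'')\bigr)=\frac{n(n-1)(n-2)}{6}. $$ -/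

import Mathlib

noncomputable section

namespace TotPos

/-- The dilogarithm `Li₂(x) = ∑_{k ≥ 1} x ^ k / k ^ 2` (convergent for `|x| ≤ 1`). -/
def Li2 (x : ℝ) : ℝ := ∑' k : ℕ, x ^ (k + 1) / ((k : ℝ) + 1) ^ 2

/-- The Rogers dilogarithm on `(0, 1)`. -/
def rogersL (x : ℝ) : ℝ := Li2 x + 1 / 2 * Real.log x * Real.log (1 - x)

/-- The normalised Rogers dilogarithm `l`, for `x > 0`. -/
def ell (x : ℝ) : ℝ := 6 / Real.pi ^ 2 * rogersL (x / (1 + x))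

variable {n : ℕ}

/-- The group `N_n` of unipotent upper triangular real matrices. -/
def IsUnipotentUpper (M : Matrix (Fin n) (Fin n) ℝ) : Prop :=
  (∀ i, M i i = 1) ∧ ∀ i j, j < i → M i j = 0

/-- The `k × k` minor with rows `r 0 < ⋯ < r (k-1)` and columns `c 0 < ⋯ < c (k-1)`. -/
def minor {k : ℕ} (M : Matrix (Fin n) (Fin n) ℝ) (r c : Fin k ↪o Fin n) : ℝ :=
  (M.submatrix r c).det

/-- The variety `N_n^+`: unipotent upper triangular matrices all of whose minors are positive,
except those that vanish identically on `N_n`. -/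
def IsTotallyPositive (M : Matrix (Fin n) (Fin n) ℝ) : Prop :=
  IsUnipotentUpper M ∧ ∀ (k : ℕ) (r c : Fin k ↪o Fin n),
    (∃ G : Matrix (Fin n) (Fin n) ℝ, IsUnipotentUpper G ∧ minor G r c ≠ 0) → 0 < minor M r c

/-- The embedding of `Fin k` onto the first `k` elements of `Fin n`. -/
def firstEmb {k : ℕ} (h : k ≤ n) : Fin k ↪o Fin n := Fin.castLEOrderEmb h

/-- The embedding of `Fin k` onto the last `k` elements of `Fin n`. -/
def lastEmb {k : ℕ} (h : k ≤ n) : Fin k ↪o Fin n :=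
  OrderEmbedding.ofStrictMono (fun j => ⟨n - k + j, by omega⟩)
    (fun i j hij => by simp only [Fin.lt_def] at hij ⊢; omega)

/-- The right flag minor `Δ_I`: rows in `I`, last `|I|` columns. -/
def rightFlag (M : Matrix (Fin n) (Fin n) ℝ) (I : Finset (Fin n)) : ℝ :=
  minor M (I.orderEmbOfFin rfl) (lastEmb (card_finset_fin_le I))

/-- The upper flag minor `Δ^J`: first `|J|` rows, columns in `J`. -/
def upperFlag (M : Matrix (Fin n) (Fin n) ℝ) (J : Finset (Fin n)) : ℝ :=
  minor M (firstEmb (card_finset_fin_le J)) (J.orderEmbOfFin rfl)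

/-- The set `[a, b]` of labels: the element `i : Fin n` carries the label `i + 1`, so that the
labels run through `1, …, n`. -/
def seg (n a b : ℕ) : Finset (Fin n) :=
  Finset.univ.filter fun i => a ≤ (i : ℕ) + 1 ∧ (i : ℕ) + 1 ≤ b

/-- The variable `Y_{abc}(M)`, for `1 ≤ a < b < c ≤ n`. -/
def Ylow (a b c : ℕ) (M : Matrix (Fin n) (Fin n) ℝ) : ℝ :=
  (rightFlag M (seg n a (b - 1) ∪ seg n (c + 1) n) * rightFlag M (seg n (a + 1) b ∪ seg n c n)) /
    (rightFlag M (seg n a b ∪ seg n (c + 1) n) * rightFlag M (seg n (a + 1) (b - 1) ∪ seg n c n))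

/-- The variable `Y^{abc}(M)`, for `1 ≤ a < b < c ≤ n`. -/
def Yup (a b c : ℕ) (M : Matrix (Fin n) (Fin n) ℝ) : ℝ :=
  (upperFlag M (seg n a b ∪ seg n (c + 1) n) * upperFlag M (seg n (a + 1) (b - 1) ∪ seg n c n)) /
    (upperFlag M (seg n a (b - 1) ∪ seg n (c + 1) n) * upperFlag M (seg n (a + 1) b ∪ seg n c n))

/-- The permutation matrix `P` with `P_{ij} = δ_{i+j,n+1}` (labels `1, …, n`). -/
def revMatrix (n : ℕ) : Matrix (Fin n) (Fin n) ℝ :=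
  Matrix.of fun i j => if (i : ℕ) + 1 + ((j : ℕ) + 1) = n + 1 then 1 else 0

/-- `P M P = M' P D M''` with `M'`, `M''` unipotent upper triangular and `D = diag d`. -/
def IsGauss (M M' M'' : Matrix (Fin n) (Fin n) ℝ) (d : Fin n → ℝ) : Prop :=
  IsUnipotentUpper M' ∧ IsUnipotentUpper M'' ∧
    revMatrix n * M * revMatrix n = M' * revMatrix n * Matrix.diagonal d * M''

open Classical in
/-- The pair `(M', M'')` determined by `P M P = M' P D M''`. For `M` invertible such a
decomposition is unique when it exists (it is the LDU decomposition of `M P`), and it exists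
for `M` in `N_n^+`; the value at other matrices is irrelevant. -/
def gaussPair (M : Matrix (Fin n) (Fin n) ℝ) :
    Matrix (Fin n) (Fin n) ℝ × Matrix (Fin n) (Fin n) ℝ :=
  if h : ∃ p : Matrix (Fin n) (Fin n) ℝ × Matrix (Fin n) (Fin n) ℝ, ∃ d, IsGauss M p.1 p.2 d
  then h.choose else (1, 1)

/-- The map `M ↦ M'`. -/
def prime (M : Matrix (Fin n) (Fin n) ℝ) : Matrix (Fin n) (Fin n) ℝ := (gaussPair M).1

/-- The map `M ↦ M''`. -/
def dprime (M : Matrix (Fin n) (Fin n) ℝ) : Matrix (Fin n) (Fin n) ℝ := (gaussPair M).2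

/-- The discrete tetrahedron `T_n` of triples `1 ≤ a < b < c ≤ n`. -/
def tetra (n : ℕ) : Finset (ℕ × ℕ × ℕ) :=
  (Finset.Icc 1 n ×ˢ Finset.Icc 1 n ×ˢ Finset.Icc 1 n).filter
    fun t => t.1 < t.2.1 ∧ t.2.1 < t.2.2

end TotPos

end

namespace TotPos

open Filter Topology

/-! ### The Rogers dilogarithm -/

/-! Write p(S) for the flag minor attached to a label set S, and X_{abc}(K) = p(aK)p(bcK) /
(p(abK)p(cK)) for a < b < c outside K. The three-term Plücker relation gives X/(1+X) = p(aK)p(bcK) /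
(p(bK)p(acK)).

For a < b < c < d outside K, the five-term relation of `rogersL` combines the X of the four triples
over K with one further cross ratio in the p(ijK) (`rogersL_pentagon`). The minors of complementary
subsets of {a,b,c,d} satisfy the same relations and produce the same further term. Subtracting
removes it and leaves `ell_exchangeRatio_eight_term`, a relation among l(X) for the four triples,
each with the fourth index outside and inside the base set.

Take K = (a,b) ∪ (c,d) and sum over all quadruples. Everything telescopes
(`sum_tetra_eq_of_eight_term`), so the sum of l(X_{abc}) over triples is the same for the base sets
(a,b) ∪ (c,n] and [1,a) ∪ (b,c).

The first base set gives the ratios of M (`crossRatio_eq_exchangeRatio`). The Gauss decomposition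
makes the flag minors of M' (or M'') proportional to those of M on reversed label sets, with a
factor depending only on the size; the second base set therefore gives the inverse ratios of M' (or
M''), with triples reversed (`crossRatio_rev_eq_inv_exchangeRatio`). Since l(x) + l(1/x) = 1, each
combined sum counts triples. -/

lemma summable_one_div_succ_sq : Summable fun k : ℕ => 1 / ((k : ℝ) + 1) ^ 2 := by
  have h := (summable_nat_add_iff (f := fun k : ℕ => 1 / (k : ℝ) ^ 2) 1).2
    (Real.summable_one_div_nat_pow.2 one_lt_two)
  simpa using h

lemma continuousOn_Li2 : ContinuousOn Li2 (Set.Icc 0 1) := by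
  refine continuousOn_tsum (u := fun k : ℕ => 1 / ((k : ℝ) + 1) ^ 2)
    (fun k => by fun_prop) summable_one_div_succ_sq ?_
  intro k x hx
  rw [Real.norm_of_nonneg (by have := hx.1; positivity)]
  gcongr
  exact pow_le_one₀ hx.1 hx.2

lemma Li2_zero : Li2 0 = 0 := by simp [Li2]

lemma Li2_one : Li2 1 = Real.pi ^ 2 / 6 := by
  have h := hasSum_zeta_two
  rw [← hasSum_nat_add_iff' 1] at h
  simpa [Li2] using h.tsum_eq

lemma hasDerivAt_Li2 {x : ℝ} (h0 : 0 < x) (h1 : x < 1) :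
    HasDerivAt Li2 (-Real.log (1 - x) / x) x := by
  -- Termwise differentiation is carried out on (-r, r), where the geometric series in r dominates
  -- the derivatives.
  obtain ⟨r, hxr, hr1⟩ := exists_between h1
  have hr0 : 0 < r := h0.trans hxr
  have key : HasDerivAt Li2 (∑' k : ℕ, x ^ k / ((k : ℝ) + 1)) x := by
    refine hasDerivAt_tsum_of_isPreconnected (u := fun k : ℕ => r ^ k)
      (t := Set.Ioo (-r) r) (y₀ := 0)
      (g := fun (k : ℕ) (y : ℝ) => y ^ (k + 1) / ((k : ℝ) + 1) ^ 2)
      (g' := fun (k : ℕ) (y : ℝ) => y ^ k / ((k : ℝ) + 1))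
      (summable_geometric_of_lt_one hr0.le hr1) isOpen_Ioo
      isPreconnected_Ioo ?_ ?_ ?_ ?_ ?_
    · intro k y _
      have h := (hasDerivAt_pow (k + 1) y).div_const (((k : ℝ) + 1) ^ 2)
      refine h.congr_deriv ?_
      have : (k : ℝ) + 1 ≠ 0 := by positivity
      push_cast
      field_simp
    · intro k y hy
      have hy' : |y| ≤ r := (abs_lt.2 hy).le
      rw [norm_div, norm_pow, Real.norm_eq_abs, Real.norm_of_nonneg (by positivity)]
      calc |y| ^ k / ((k : ℝ) + 1) ≤ |y| ^ k :=
            div_le_self (by positivity) (by linarith [(Nat.cast_nonneg k : (0 : ℝ) ≤ k)])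
        _ ≤ r ^ k := by gcongr
    · exact ⟨by linarith, hr0⟩
    · simp
    · exact ⟨by linarith, hxr⟩
  convert key using 1
  have hs := (Real.hasSum_pow_div_log_of_abs_lt_one
    (abs_lt.2 ⟨by linarith, h1⟩ : |x| < 1)).div_const x
  rw [← hs.tsum_eq]
  congr 1
  ext k
  rw [pow_succ]
  field_simp

lemma hasDerivAt_rogersL {x : ℝ} (h0 : 0 < x) (h1 : x < 1) :
    HasDerivAt rogersL (-(Real.log (1 - x) / x + Real.log x / (1 - x)) / 2) x := by
  have h1' : (1 : ℝ) - x ≠ 0 := by linarith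
  have hl := Real.hasDerivAt_log h0.ne'
  have hl' := ((hasDerivAt_id x).const_sub 1).log h1'
  have h := (hasDerivAt_Li2 h0 h1).add ((hl.const_mul (1 / 2)).mul hl')
  refine h.congr_deriv ?_
  simp only [id]
  field_simp
  ring

/-- The product splits as (x log x) · (log(1 - x)/x); the first factor tends to 0 and the second to
-1. -/
lemma tendsto_log_mul_log_one_sub :
    Tendsto (fun x : ℝ => Real.log x * Real.log (1 - x)) (𝓝[>] 0) (𝓝 0) := by
  have hd : HasDerivAt (fun x : ℝ => Real.log (1 - x)) (-1) 0 := by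
    simpa using ((hasDerivAt_id (0 : ℝ)).const_sub 1).log (by norm_num)
  have h1 : Tendsto (fun x : ℝ => x⁻¹ * Real.log (1 - x)) (𝓝[>] 0) (𝓝 (-1)) := by
    have := hd.tendsto_slope_zero_right
    simpa using this
  have h2 : Tendsto (fun x : ℝ => Real.log x * x) (𝓝[>] 0) (𝓝 0) := by
    simpa using tendsto_log_mul_rpow_nhdsGT_zero (one_pos)
  have h3 := h2.mul h1
  rw [zero_mul] at h3
  refine h3.congr' ?_
  filter_upwards [self_mem_nhdsWithin] with x hx
  have : x ≠ 0 := ne_of_gt hx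
  field_simp

lemma tendsto_rogersL_zero : Tendsto rogersL (𝓝[>] 0) (𝓝 0) := by
  have h1 : Tendsto Li2 (𝓝[>] 0) (𝓝 0) := by
    have := (continuousOn_Li2 0 (by simp)).tendsto
    rw [Li2_zero] at this
    refine this.mono_left ?_
    rw [← nhdsWithin_Ioo_eq_nhdsGT (zero_lt_one' ℝ)]
    exact nhdsWithin_mono _ Set.Ioo_subset_Icc_self
  have h := h1.add (tendsto_log_mul_log_one_sub.const_mul (1 / 2))
  simp only [mul_zero, add_zero] at h
  refine h.congr fun x => ?_
  rw [rogersL, mul_assoc]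

lemma tendsto_rogersL_one_sub :
    Tendsto (fun x => rogersL (1 - x)) (𝓝[>] 0) (𝓝 (Real.pi ^ 2 / 6)) := by
  have h1 : Tendsto (fun x => Li2 (1 - x)) (𝓝[>] 0) (𝓝 (Real.pi ^ 2 / 6)) := by
    have := (continuousOn_Li2 1 (by simp)).tendsto
    rw [Li2_one] at this
    refine this.comp (tendsto_nhdsWithin_iff.2 ⟨?_, ?_⟩)
    · have : Tendsto (fun x : ℝ => 1 - x) (𝓝 0) (𝓝 (1 - 0)) := by
        exact (continuous_const.sub continuous_id).tendsto 0
      rw [sub_zero] at this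
      exact this.mono_left nhdsWithin_le_nhds
    · filter_upwards [Ioo_mem_nhdsGT (zero_lt_one' ℝ)] with x hx
      exact ⟨by linarith [hx.2], by linarith [hx.1]⟩
  have h := h1.add (tendsto_log_mul_log_one_sub.const_mul (1 / 2))
  simp only [mul_zero, add_zero] at h
  refine h.congr fun x => ?_
  rw [rogersL, sub_sub_cancel]
  ring

/-- A function with vanishing derivative on `(0, 1)` equals its limit at `0`. -/
lemma eq_of_hasDerivAt_zero_of_tendsto {g : ℝ → ℝ} {c x : ℝ}
    (hg : ∀ y ∈ Set.Ioo (0 : ℝ) 1, HasDerivAt g 0 y) (hc : Tendsto g (𝓝[>] 0) (𝓝 c))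
    (hx : x ∈ Set.Ioo (0 : ℝ) 1) : g x = c := by
  have hconst : ∀ y ∈ Set.Ioo (0 : ℝ) 1, g y = g x := by
    intro y hy
    refine (convex_Ioo (0 : ℝ) 1).is_const_of_fderivWithin_eq_zero (𝕜 := ℝ)
      (fun z hz => (hg z hz).differentiableAt.differentiableWithinAt) (fun z hz => ?_) hy hx
    rw [fderivWithin_of_isOpen isOpen_Ioo hz]
    ext
    simpa using (hg z hz).deriv
  refine tendsto_nhds_unique (Tendsto.congr' ?_ tendsto_const_nhds) hc
  filter_upwards [Ioo_mem_nhdsGT (zero_lt_one' ℝ)] with y hy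
  exact (hconst y hy).symm

lemma rogersL_add_rogersL_one_sub {x : ℝ} (hx : x ∈ Set.Ioo (0 : ℝ) 1) :
    rogersL x + rogersL (1 - x) = Real.pi ^ 2 / 6 := by
  refine eq_of_hasDerivAt_zero_of_tendsto (g := fun x => rogersL x + rogersL (1 - x)) ?_ ?_ hx
  · intro y hy
    have h1 := hasDerivAt_rogersL hy.1 hy.2
    have h2 := (hasDerivAt_rogersL (x := 1 - y) (by linarith [hy.2]) (by linarith [hy.1])).comp y
      ((hasDerivAt_id y).const_sub 1)
    refine (h1.add h2).congr_deriv ?_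
    simp only [sub_sub_cancel]
    ring
  · simpa using tendsto_rogersL_zero.add tendsto_rogersL_one_sub

/-- The five-term relation of the Rogers dilogarithm. -/
lemma rogersL_five_term {u v : ℝ} (hu : u ∈ Set.Ioo (0 : ℝ) 1) (hv : v ∈ Set.Ioo (0 : ℝ) 1) :
    rogersL u + rogersL v = rogersL (u * v) + rogersL (u * (1 - v) / (1 - u * v)) +
      rogersL (v * (1 - u) / (1 - u * v)) := by
  obtain ⟨hv0, hv1⟩ := hv
  have hv1' : 0 < 1 - v := by linarith
  suffices h : rogersL u - rogersL (u * v) - rogersL (u * (1 - v) / (1 - u * v)) -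
      rogersL (v * (1 - u) / (1 - u * v)) = -rogersL v by linarith
  -- With v fixed, the u-derivative vanishes; as u → 0 the first three terms tend to 0 and the last
  -- argument tends to v.
  refine eq_of_hasDerivAt_zero_of_tendsto (g := fun u => rogersL u - rogersL (u * v) -
    rogersL (u * (1 - v) / (1 - u * v)) - rogersL (v * (1 - u) / (1 - u * v))) ?_ ?_ hu
  · rintro y ⟨hy0, hy1⟩
    have hy1' : 0 < 1 - y := by linarith
    have hyv : 0 < y * v := mul_pos hy0 hv0
    have hyv' : 0 < 1 - y * v := by nlinarith
    have hne := hyv'.ne'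
    have es : 1 - y * (1 - v) / (1 - y * v) = (1 - y) / (1 - y * v) := by
      rw [eq_div_iff hne, sub_mul, div_mul_cancel₀ _ hne]; ring
    have et : 1 - v * (1 - y) / (1 - y * v) = (1 - v) / (1 - y * v) := by
      rw [eq_div_iff hne, sub_mul, div_mul_cancel₀ _ hne]; ring
    have hs0 : 0 < y * (1 - v) / (1 - y * v) := by positivity
    have ht0 : 0 < v * (1 - y) / (1 - y * v) := by positivity
    have hs1 : y * (1 - v) / (1 - y * v) < 1 := by
      have : 0 < (1 - y) / (1 - y * v) := by positivity
      linarith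
    have ht1 : v * (1 - y) / (1 - y * v) < 1 := by
      have : 0 < (1 - v) / (1 - y * v) := by positivity
      linarith
    have dden : HasDerivAt (fun y : ℝ => 1 - y * v) (-v) y := by
      simpa using ((hasDerivAt_id y).mul_const v).const_sub 1
    have d1 := hasDerivAt_rogersL hy0 hy1
    have d2 := (hasDerivAt_rogersL (x := y * v) hyv (by linarith)).comp y
      ((hasDerivAt_id y).mul_const v)
    have d3 := (hasDerivAt_rogersL hs0 hs1).comp y
      (((hasDerivAt_id y).mul_const (1 - v)).div dden hyv'.ne')
    have d4 := (hasDerivAt_rogersL ht0 ht1).comp y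
      ((((hasDerivAt_id y).const_sub 1).const_mul v).div dden hyv'.ne')
    refine (((d1.sub d2).sub d3).sub d4).congr_deriv ?_
    simp only [id]
    rw [es, et, Real.log_div (by positivity) (by positivity),
      Real.log_div (by positivity) (by positivity), Real.log_div (by positivity) (by positivity),
      Real.log_div (by positivity) (by positivity), Real.log_mul hy0.ne' hv1'.ne',
      Real.log_mul hv0.ne' hy1'.ne', Real.log_mul hy0.ne' hv0.ne']
    field_simp
    ring
  · have hc : ∀ f : ℝ → ℝ, ContinuousAt f 0 → f 0 = 0 →
        (∀ y ∈ Set.Ioo (0 : ℝ) 1, 0 < f y) →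
        Tendsto (fun y => rogersL (f y)) (𝓝[>] 0) (𝓝 0) := by
      intro f hf hf0 hpos
      refine tendsto_rogersL_zero.comp (tendsto_nhdsWithin_iff.2 ⟨?_, ?_⟩)
      · have := hf.tendsto
        rw [hf0] at this
        exact this.mono_left nhdsWithin_le_nhds
      · filter_upwards [Ioo_mem_nhdsGT (zero_lt_one' ℝ)] with y hy
        exact hpos y hy
    have hden : ContinuousAt (fun y : ℝ => 1 - y * v) 0 := by fun_prop
    have l2 := hc (fun y => y * v) (by fun_prop) (by simp) (fun y hy => mul_pos hy.1 hv0)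
    have l3 := hc (fun y => y * (1 - v) / (1 - y * v))
      (ContinuousAt.div (by fun_prop) hden (by simp)) (by simp) (fun y hy => by
        have h1 := hy.1
        have h2 : y * v < 1 := by nlinarith [hy.1, hy.2]
        exact div_pos (mul_pos h1 hv1') (by linarith))
    have l4 : Tendsto (fun y => rogersL (v * (1 - y) / (1 - y * v))) (𝓝[>] 0)
        (𝓝 (rogersL v)) := by
      have hcv := (hasDerivAt_rogersL hv0 hv1).continuousAt.tendsto
      have hf : ContinuousAt (fun y : ℝ => v * (1 - y) / (1 - y * v)) 0 :=
        ContinuousAt.div (by fun_prop) hden (by simp)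
      have hf' := hf.tendsto
      simp only [sub_zero, mul_one, zero_mul, div_one] at hf'
      exact (hcv.comp hf').mono_left nhdsWithin_le_nhds
    simpa using ((tendsto_rogersL_zero.sub l2).sub l3).sub l4

lemma ell_add_ell_inv {x : ℝ} (hx : 0 < x) : ell x + ell x⁻¹ = 1 := by
  have h := rogersL_add_rogersL_one_sub (x := x / (1 + x))
    ⟨by positivity, by rw [div_lt_one (by positivity)]; linarith⟩
  have e : x⁻¹ / (1 + x⁻¹) = 1 - x / (1 + x) := by field_simp; ring
  rw [ell, ell, e, ← mul_add, h]
  field_simp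

end TotPos

namespace TotPos

open Matrix

variable {n : ℕ}

/-! ### Plücker relations for flag minors -/

/-- The square matrix with rows `x`, `y`, followed by the rows `R`. -/
def consRows {k : ℕ} (x y : Fin (k + 2) → ℝ) (R : Fin k → Fin (k + 2) → ℝ) :
    Matrix (Fin (k + 2)) (Fin (k + 2)) ℝ :=
  of (vecCons x (vecCons y R))

lemma det_cons_cons_swap {k : ℕ} (R : Fin k → Fin (k + 2) → ℝ) (x y : Fin (k + 2) → ℝ) :
    det (consRows x y R) = - det (consRows y x R) := by
  have h := det_permute (Equiv.swap (0 : Fin (k + 2)) 1) (consRows y x R)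
  rw [Equiv.Perm.sign_swap (by simp)] at h
  simp only [Units.val_neg, Units.val_one, Int.cast_neg, Int.cast_one, neg_one_mul] at h
  rw [← h]
  congr 1
  ext i j
  rw [submatrix_apply]
  refine Fin.cases ?_ (fun i => Fin.cases ?_ (fun i => ?_) i) i
  · rw [Equiv.swap_apply_left]; rfl
  · rw [Fin.succ_zero_eq_one, Equiv.swap_apply_right]; rfl
  · rw [Equiv.swap_apply_of_ne_of_ne (by simp [Fin.ext_iff]) (by simp [Fin.ext_iff])]; rfl

/-- The three-term Grassmann–Plücker relation. -/
lemma det_cons_cons_mul_det_cons_cons {k : ℕ} (R : Fin k → Fin (k + 2) → ℝ)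
    (a b c d : Fin (k + 2) → ℝ) :
    det (consRows a c R) * det (consRows b d R) =
      det (consRows a b R) * det (consRows c d R) +
        det (consRows a d R) * det (consRows b c R) := by
  set W : Matrix (Fin (k + 2)) (Fin (k + 2)) ℝ := consRows a b R with hW
  -- φ(x) = det(c, x, R) is realised as a Cramer coordinate to obtain linearity for free. It kills
  -- the rows of R, so applying it to the Cramer expansion of d in the rows a, b, R leaves only the
  -- a and b terms.
  set φ : (Fin (k + 2) → ℝ) →ₗ[ℝ] ℝ :=
    (LinearMap.proj 1).comp (cramer (consRows c 0 R)ᵀ) with hφ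
  have hφ_apply : ∀ x, φ x = det (consRows c x R) := by
    intro x
    simp only [hφ, LinearMap.comp_apply, LinearMap.proj_apply]
    rw [cramer_transpose_apply]
    congr 1
    ext i j
    refine Fin.cases ?_ (fun i => Fin.cases ?_ (fun i => ?_) i) i
    · rw [updateRow_ne (by simp)]; rfl
    · change updateRow _ 1 x 1 j = _
      rw [updateRow_self]; rfl
    · rw [updateRow_ne (by simp [Fin.ext_iff])]; rfl
  have hφR : ∀ i, φ (R i) = 0 := by
    intro i
    rw [hφ_apply]
    exact det_zero_of_row_eq (i := 1) (j := i.succ.succ) (by simp [Fin.ext_iff]) rfl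
  have h0 : det (W.updateRow 0 d) = - det (consRows b d R) := by
    rw [← det_cons_cons_swap]
    congr 1
    ext i j
    refine Fin.cases ?_ (fun i => ?_) i
    · rw [updateRow_self]; rfl
    · rw [updateRow_ne (by simp)]; rfl
  have h1 : det (W.updateRow 1 d) = det (consRows a d R) := by
    congr 1
    ext i j
    refine Fin.cases ?_ (fun i => Fin.cases ?_ (fun i => ?_) i) i
    · rw [updateRow_ne (by simp)]; rfl
    · change updateRow _ 1 d 1 j = _
      rw [updateRow_self]; rfl
    · rw [updateRow_ne (by simp [Fin.ext_iff])]; rfl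
  have hexp : det W • d = ∑ i, det (W.updateRow i d) • W i := by
    rw [← det_transpose, ← mulVec_cramer]
    ext j
    simp [mulVec, dotProduct, cramer_transpose_apply, mul_comm]
  have key := congrArg φ hexp
  rw [map_smul, map_sum, Fin.sum_univ_succ, Fin.sum_univ_succ] at key
  have hz : ∑ i : Fin k, φ (det (W.updateRow i.succ.succ d) • W i.succ.succ) = 0 := by
    refine Finset.sum_eq_zero fun i _ => ?_
    rw [map_smul]
    change _ • φ (R i) = 0
    rw [hφR, smul_zero]
  rw [hz, map_smul, map_smul] at key
  change _ = det (W.updateRow 0 d) • φ a + (det (W.updateRow 1 d) • φ b + 0) at key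
  rw [h0, h1] at key
  rw [hφ_apply, hφ_apply, hφ_apply, det_cons_cons_swap R c a,
    det_cons_cons_swap R c b] at key
  simp only [smul_eq_mul] at key
  linarith

/-- The minor of the leading columns of the family of rows `v`, in the rows `r`. -/
def rowDet {ι : Type*} (v : ι → ℕ → ℝ) {m : ℕ} (r : Fin m → ι) : ℝ :=
  det (of fun i j : Fin m => v (r i) j)

/-- The flag minor of the rows in `I`, in increasing order. -/
def flagMinor (v : Fin n → ℕ → ℝ) (I : Finset (Fin n)) : ℝ :=
  rowDet v (I.orderEmbOfFin rfl)

lemma flagMinor_eq (v : Fin n → ℕ → ℝ) (I : Finset (Fin n)) {m : ℕ} (h : I.card = m) :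
    flagMinor v I = rowDet v (I.orderEmbOfFin h) := by
  subst h; rfl

/-- The Vandermonde product, whose sign is the sign of the permutation that sorts `r`. -/
def vprod {m : ℕ} (r : Fin m → Fin n) : ℝ :=
  ∏ i, ∏ j ∈ Finset.Ioi i, (((r j : ℕ) : ℝ) - ((r i : ℕ) : ℝ))

lemma vprod_eq_det {m : ℕ} (r : Fin m → Fin n) :
    vprod r = rowDet (fun (i : Fin n) (j : ℕ) => ((i : ℕ) : ℝ) ^ j) r := by
  rw [vprod, ← det_vandermonde fun i => ((r i : ℕ) : ℝ)]
  rfl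

lemma vprod_pos {m : ℕ} {r : Fin m → Fin n} (hr : StrictMono r) : 0 < vprod r :=
  Finset.prod_pos fun _ _ => Finset.prod_pos fun _ hj =>
    sub_pos.2 (Nat.cast_lt.2 (hr (Finset.mem_Ioi.1 hj)))

lemma vprod_cons {m : ℕ} (x : Fin n) (r : Fin m → Fin n) :
    vprod (vecCons x r) = (∏ i, (((r i : ℕ) : ℝ) - ((x : ℕ) : ℝ))) * vprod r := by
  simp only [vprod, Fin.prod_univ_succ, Fin.prod_Ioi_zero, Fin.prod_Ioi_succ, cons_val_zero,
    cons_val_succ]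

lemma rowDet_comp_perm {ι : Type*} (v : ι → ℕ → ℝ) {m : ℕ} (r : Fin m → ι)
    (σ : Equiv.Perm (Fin m)) :
    rowDet v (r ∘ σ) = ((Equiv.Perm.sign σ : ℤ) : ℝ) * rowDet v r :=
  det_permute σ (of fun i j : Fin m => v (r i) j)

/-- The Vandermonde product is itself a `rowDet`, so sorting r changes it by the same sign as any
other `rowDet`; it is positive once r is sorted, so its sign is that of the sorting permutation. -/
lemma flagMinor_eq_sign_mul_rowDet (v : Fin n → ℕ → ℝ) {m : ℕ} {r : Fin m → Fin n}
    (hr : Function.Injective r) {I : Finset (Fin n)} (hI : I = Finset.univ.image r) :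
    flagMinor v I = ((SignType.sign (vprod r) : ℤ) : ℝ) * rowDet v r := by
  have hcard : I.card = m := by
    rw [hI, Finset.card_image_of_injective _ hr, Finset.card_fin]
  have hmem : ∀ i, r i ∈ I := fun i => by simp [hI]
  let τ : Fin m → Fin m := fun i => (I.orderIsoOfFin hcard).symm ⟨r i, hmem i⟩
  have hτ : Function.Injective τ := fun i j h => hr (by simpa [τ] using h)
  let σ : Equiv.Perm (Fin m) := Equiv.ofBijective τ (Finite.injective_iff_bijective.1 hτ)
  have hrσ : r = I.orderEmbOfFin hcard ∘ σ := by
    ext i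
    simp [σ, τ, Finset.orderEmbOfFin]
  rw [flagMinor_eq v I hcard]
  have hs : SignType.sign (vprod r) = SignType.sign ((Equiv.Perm.sign σ : ℤ) : ℝ) := by
    rw [vprod_eq_det, hrσ, rowDet_comp_perm, ← vprod_eq_det, sign_mul,
      sign_pos (vprod_pos (I.orderEmbOfFin hcard).strictMono), mul_one]
  rw [hs, hrσ, rowDet_comp_perm]
  rcases Int.units_eq_one_or (Equiv.Perm.sign σ) with h | h <;> simp [h]

/-- The sign relating the position of `x` with respect to `K`. -/
noncomputable def posSign (K : Finset (Fin n)) (x : Fin n) : ℝ :=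
  ((SignType.sign (∏ i, (((K.orderEmbOfFin rfl i : ℕ) : ℝ) - ((x : ℕ) : ℝ))) : ℤ) : ℝ)

lemma image_vecCons {m : ℕ} (x : Fin n) (r : Fin m → Fin n) :
    Finset.univ.image (vecCons x r) = insert x (Finset.univ.image r) := by
  ext y
  simp [Fin.exists_fin_succ, eq_comm]

lemma injective_vecCons {m : ℕ} {x : Fin n} {r : Fin m → Fin n} (hr : Function.Injective r)
    (hx : x ∉ Finset.univ.image r) : Function.Injective (vecCons x r) :=
  Fin.cons_injective_iff.2 ⟨by simpa using hx, hr⟩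

lemma flagMinor_insert (v : Fin n → ℕ → ℝ) {K : Finset (Fin n)} {x : Fin n} (hx : x ∉ K) :
    flagMinor v (insert x K) = posSign K x * rowDet v (vecCons x (K.orderEmbOfFin rfl)) := by
  have him : Finset.univ.image (K.orderEmbOfFin rfl) = K := by simp
  rw [flagMinor_eq_sign_mul_rowDet v
    (injective_vecCons (K.orderEmbOfFin rfl).injective (by rwa [him]))
    (by rw [image_vecCons, him]), vprod_cons, sign_mul,
    sign_pos (vprod_pos (K.orderEmbOfFin rfl).strictMono), mul_one]
  rfl

lemma flagMinor_insert_insert (v : Fin n → ℕ → ℝ) {K : Finset (Fin n)} {x y : Fin n}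
    (hx : x ∉ K) (hy : y ∉ K) (hxy : x < y) :
    flagMinor v (insert x (insert y K)) =
      posSign K x * posSign K y * rowDet v (vecCons x (vecCons y (K.orderEmbOfFin rfl))) := by
  have him : Finset.univ.image (K.orderEmbOfFin rfl) = K := by simp
  have hinj := injective_vecCons (x := y) (K.orderEmbOfFin rfl).injective (by rwa [him])
  have hpos : (0 : ℝ) < ((y : ℕ) : ℝ) - ((x : ℕ) : ℝ) := sub_pos.2 (Nat.cast_lt.2 hxy)
  rw [flagMinor_eq_sign_mul_rowDet v
    (injective_vecCons (x := x) hinj (by rw [image_vecCons, him]; simp [hx, hxy.ne]))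
    (by rw [image_vecCons, image_vecCons, him]), vprod_cons, vprod_cons, Fin.prod_univ_succ]
  simp only [cons_val_zero, cons_val_succ, sign_mul, sign_pos hpos, one_mul, mul_one,
    sign_pos (vprod_pos (K.orderEmbOfFin rfl).strictMono), posSign]
  push_cast
  ring

lemma rowDet_cons_cons {ι : Type*} (v : ι → ℕ → ℝ) {k : ℕ} (r : Fin k → ι) (x y : ι) :
    rowDet v (vecCons x (vecCons y r)) =
      det (consRows (fun j => v x j) (fun j => v y j) fun i j => v (r i) j) := by
  rw [rowDet]
  congr 1
  ext i j
  refine Fin.cases rfl (fun i => Fin.cases rfl (fun i => rfl) i) i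

/-- Expansion along the unit row drops the last column. This lets a minor of size k + 1 enter the
Grassmann–Plücker relation of size k + 2. -/
lemma rowDet_cons {ι : Type*} (v : ι → ℕ → ℝ) {k : ℕ} (r : Fin k → ι) (x : ι) :
    det (consRows (fun j => v x j) (Pi.single (Fin.last (k + 1)) 1) fun i j => v (r i) j) =
      (-1) ^ k * rowDet v (vecCons x r) := by
  rw [det_succ_row _ 1, Finset.sum_eq_single (Fin.last (k + 1))]
  · have h1 : consRows (fun j => v x j) (Pi.single (Fin.last (k + 1)) 1) (fun i j => v (r i) j) 1
        (Fin.last (k + 1)) = 1 := by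
      change (Pi.single (Fin.last (k + 1)) (1 : ℝ) : Fin (k + 2) → ℝ) (Fin.last (k + 1)) = 1
      simp
    rw [h1, rowDet]
    congr 1
    · simp [pow_add, pow_succ]
    · congr 1
      ext i j
      refine Fin.cases ?_ (fun i => ?_) i
      · simp [submatrix_apply]
        rfl
      · have : (1 : Fin (k + 2)).succAbove i.succ = i.succ.succ := by
          rw [← Fin.succ_zero_eq_one, Fin.succ_succAbove_succ, Fin.zero_succAbove]
        simp [submatrix_apply, this]
        rfl
  · intro j _ hj
    have h1 : consRows (fun j => v x j) (Pi.single (Fin.last (k + 1)) 1)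
        (fun i j => v (r i) j) 1 j = 0 := by
      change (Pi.single (Fin.last (k + 1)) (1 : ℝ) : Fin (k + 2) → ℝ) j = 0
      simp [hj]
    rw [h1]
    ring
  · simp

lemma flagMinor_plucker_three (v : Fin n → ℕ → ℝ) {K : Finset (Fin n)} {a b c : Fin n}
    (hab : a < b) (hbc : b < c) (ha : a ∉ K) (hb : b ∉ K) (hc : c ∉ K) :
    flagMinor v (insert b K) * flagMinor v (insert a (insert c K)) =
      flagMinor v (insert a K) * flagMinor v (insert b (insert c K)) +
        flagMinor v (insert a (insert b K)) * flagMinor v (insert c K) := by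
  -- The fourth vector is the last unit vector, which turns the Grassmann relation into the
  -- incidence relation between consecutive sizes.
  have key := det_cons_cons_mul_det_cons_cons
    (fun i (j : Fin (K.card + 2)) => v (K.orderEmbOfFin rfl i) j)
    (fun j => v a j) (fun j => v b j) (fun j => v c j) (Pi.single (Fin.last (K.card + 1)) 1)
  simp only [rowDet_cons, ← rowDet_cons_cons] at key
  simp only [flagMinor_insert_insert v ha hc (hab.trans hbc), flagMinor_insert_insert v ha hb hab,
    flagMinor_insert_insert v hb hc hbc, flagMinor_insert v ha, flagMinor_insert v hb,
    flagMinor_insert v hc]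
  refine mul_left_cancel₀ (pow_ne_zero K.card (neg_ne_zero.2 (one_ne_zero (α := ℝ)))) ?_
  -- Each of the three products involves each of a, b, c exactly once, so the sorting signs form a
  -- common factor.
  linear_combination posSign K a * posSign K b * posSign K c * key

end TotPos

namespace TotPos

/-! ### The eight-term relation and its summation -/

/-- This is the five-term relation with u and v the ratios of the triples 124 and 234. Their product
is the ratio of 134, and the incidence relations factor 1 - u, 1 - v and 1 - uv. -/
lemma rogersL_pentagon {p1 p2 p3 p4 p12 p13 p14 p23 p24 p34 : ℝ} (h1 : 0 < p1) (h2 : 0 < p2)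
    (h3 : 0 < p3) (h4 : 0 < p4) (h12 : 0 < p12) (h13 : 0 < p13) (h14 : 0 < p14) (h23 : 0 < p23)
    (h24 : 0 < p24) (h34 : 0 < p34) (r124 : p2 * p14 = p1 * p24 + p12 * p4)
    (r134 : p3 * p14 = p1 * p34 + p13 * p4) (r234 : p3 * p24 = p2 * p34 + p23 * p4) :
    rogersL (p1 * p24 / (p2 * p14)) + rogersL (p2 * p34 / (p3 * p24)) =
      rogersL (p1 * p34 / (p3 * p14)) + rogersL (p1 * p23 / (p2 * p13)) +
        rogersL (p12 * p34 / (p13 * p24)) := by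
  have compl : ∀ {x y z : ℝ}, 0 < z → z = x + y → 1 - x / z = y / z := by
    intro x y z hz h
    rw [eq_div_iff hz.ne', sub_mul, div_mul_cancel₀ _ hz.ne']
    linarith
  have e1 := compl (by positivity) r124
  have e2 := compl (by positivity) r234
  have e3 := compl (by positivity) r134
  have emul : p1 * p24 / (p2 * p14) * (p2 * p34 / (p3 * p24)) = p1 * p34 / (p3 * p14) := by
    field_simp
  have lt : ∀ {x y : ℝ}, 1 - x = y → 0 < y → x < 1 := by
    intro x y h hy
    linarith
  have key := rogersL_five_term (u := p1 * p24 / (p2 * p14)) (v := p2 * p34 / (p3 * p24))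
    ⟨by positivity, lt e1 (by positivity)⟩ ⟨by positivity, lt e2 (by positivity)⟩
  rw [emul, e1, e2, e3] at key
  rw [key]
  congr 2
  · congr 1
    field_simp
  · field_simp

/-- Positivity and the three-term incidence relations satisfied by the flag minors of a totally
positive matrix, as functions of the set of labels. -/
structure PositivePlucker (n : ℕ) (p : Finset ℕ → ℝ) : Prop where
  pos : ∀ S, 0 < p S
  three_term : ∀ {K : Finset ℕ} {a b c : ℕ}, 1 ≤ a → a < b → b < c → c ≤ n →
    a ∉ K → b ∉ K → c ∉ K →
    p (insert b K) * p (insert a (insert c K)) =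
      p (insert a K) * p (insert b (insert c K)) + p (insert a (insert b K)) * p (insert c K)

/-- The ratio of the two terms in the exchange relation for `a < b < c` over `K`. -/
noncomputable def exchangeRatio (p : Finset ℕ → ℝ) (a b c : ℕ) (K : Finset ℕ) : ℝ :=
  (p (insert a K) * p (insert b (insert c K))) / (p (insert a (insert b K)) * p (insert c K))

lemma exchangeRatio_pos {n : ℕ} {p : Finset ℕ → ℝ} (hp : PositivePlucker n p) (a b c : ℕ)
    (K : Finset ℕ) : 0 < exchangeRatio p a b c K :=
  div_pos (mul_pos (hp.pos _) (hp.pos _)) (mul_pos (hp.pos _) (hp.pos _))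

lemma ell_exchangeRatio {n : ℕ} {p : Finset ℕ → ℝ} (hp : PositivePlucker n p) {K : Finset ℕ}
    {a b c : ℕ} (ha : 1 ≤ a) (hab : a < b) (hbc : b < c) (hc : c ≤ n) (haK : a ∉ K)
    (hbK : b ∉ K) (hcK : c ∉ K) :
    ell (exchangeRatio p a b c K) = 6 / Real.pi ^ 2 * rogersL
      (p (insert a K) * p (insert b (insert c K)) /
        (p (insert b K) * p (insert a (insert c K)))) := by
  rw [ell, exchangeRatio, hp.three_term ha hab hbc hc haK hbK hcK]
  have h1 := hp.pos (insert a K)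
  have h2 := hp.pos (insert b (insert c K))
  have h3 := hp.pos (insert a (insert b K))
  have h4 := hp.pos (insert c K)
  congr 2
  have h5 : 0 < p (insert a (insert b K)) * p (insert c K) := by positivity
  have h6 : 0 < p (insert a K) * p (insert b (insert c K)) := by positivity
  field_simp
  rw [add_comm]

lemma ell_exchangeRatio_eight_term {n : ℕ} {p : Finset ℕ → ℝ} (hp : PositivePlucker n p)
    {K : Finset ℕ} {a b c d : ℕ} (ha : 1 ≤ a) (hab : a < b) (hbc : b < c) (hcd : c < d)
    (hd : d ≤ n) (haK : a ∉ K) (hbK : b ∉ K) (hcK : c ∉ K) (hdK : d ∉ K) :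
    ell (exchangeRatio p a b c (insert d K)) - ell (exchangeRatio p a b c K) +
      (ell (exchangeRatio p a b d K) - ell (exchangeRatio p a b d (insert c K))) +
      (ell (exchangeRatio p a c d (insert b K)) - ell (exchangeRatio p a c d K)) +
      (ell (exchangeRatio p b c d K) - ell (exchangeRatio p b c d (insert a K))) = 0 := by
  have nin : ∀ {x y : ℕ}, x ≠ y → x ∉ K → x ∉ insert y K := by
    intro x y h1 h2
    simp [h1, h2]
  have hb : 1 ≤ b := by omega
  have hc : 1 ≤ c := by omega
  have nab : a ≠ b := by omega
  have nac : a ≠ c := by omega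
  have nad : a ≠ d := by omega
  have nbc : b ≠ c := by omega
  have nbd : b ≠ d := by omega
  have ncd : c ≠ d := by omega
  have hcn : c ≤ n := by omega
  have r124 := hp.three_term ha hab (hbc.trans hcd) hd haK hbK hdK
  have r134 := hp.three_term ha (hab.trans hbc) hcd hd haK hcK hdK
  have r234 := hp.three_term hb hbc hcd hd hbK hcK hdK
  have s124 := hp.three_term ha hab (hbc.trans hcd) hd (nin nac haK) (nin nbc hbK)
    (nin ncd.symm hdK)
  have s134 := hp.three_term ha (hab.trans hbc) hcd hd (nin nab haK) (nin nbc.symm hcK)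
    (nin nbd.symm hdK)
  have s234 := hp.three_term hb hbc hcd hd (nin nab.symm hbK) (nin nac.symm hcK)
    (nin nad.symm hdK)
  rw [ell_exchangeRatio hp ha hab hbc hcn haK hbK hcK,
    ell_exchangeRatio hp ha hab (hbc.trans hcd) hd haK hbK hdK,
    ell_exchangeRatio hp ha (hab.trans hbc) hcd hd haK hcK hdK,
    ell_exchangeRatio hp hb hbc hcd hd hbK hcK hdK,
    ell_exchangeRatio hp ha hab hbc hcn (nin nad haK) (nin nbd hbK) (nin ncd hcK),
    ell_exchangeRatio hp ha hab (hbc.trans hcd) hd (nin nac haK) (nin nbc hbK)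
      (nin ncd.symm hdK),
    ell_exchangeRatio hp ha (hab.trans hbc) hcd hd (nin nab haK) (nin nbc.symm hcK)
      (nin nbd.symm hdK),
    ell_exchangeRatio hp hb hbc hcd hd (nin nab.symm hbK) (nin nac.symm hcK)
      (nin nad.symm hdK)]
  -- Nested insertions are put in the order a, b, c, d, so that equal minors become syntactically
  -- equal.
  simp only [Finset.insert_comm d c, Finset.insert_comm d b, Finset.insert_comm d a,
    Finset.insert_comm c b, Finset.insert_comm c a, Finset.insert_comm b a] at *
  have k1 := rogersL_pentagon (hp.pos _) (hp.pos _) (hp.pos _) (hp.pos _) (hp.pos _) (hp.pos _)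
    (hp.pos _) (hp.pos _) (hp.pos _) (hp.pos _) r124 r134 r234
  -- Each index set is replaced by its complement in {a, b, c, d}. The last term of the pentagon is
  -- unchanged and cancels in k1 - k2.
  have k2 := rogersL_pentagon (hp.pos (insert b (insert c (insert d K))))
    (hp.pos (insert a (insert c (insert d K)))) (hp.pos (insert a (insert b (insert d K))))
    (hp.pos (insert a (insert b (insert c K)))) (hp.pos (insert c (insert d K)))
    (hp.pos (insert b (insert d K))) (hp.pos (insert b (insert c K)))
    (hp.pos (insert a (insert d K))) (hp.pos (insert a (insert c K)))
    (hp.pos (insert a (insert b K))) (by linarith) (by linarith) (by linarith)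
  simp only [mul_comm] at k1 k2 ⊢
  linear_combination (6 / Real.pi ^ 2) * (k1 - k2)

/-- Sums over initial segments of an interval telescope. -/
lemma sum_Ioo_insert_sub (F : Finset ℕ → ℝ) (a b : ℕ) :
    ∑ e ∈ Finset.Ioo a b, (F (insert e (Finset.Ioo a e)) - F (Finset.Ioo a e)) =
      F (Finset.Ioo a b) - F ∅ := by
  induction b with
  | zero => simp
  | succ b ih =>
    rcases lt_or_ge a b with h | h
    · have e : Finset.Ioo a (b + 1) = insert b (Finset.Ioo a b) := by
        ext x; simp only [Finset.mem_Ioo, Finset.mem_insert]; omega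
      rw [e, Finset.sum_insert (by simp), ih]
      ring
    · have e : Finset.Ioo a (b + 1) = ∅ := by
        ext x; simp only [Finset.mem_Ioo, Finset.notMem_empty, iff_false]; omega
      simp [e]

/-- Sums over final segments of an interval telescope. -/
lemma sum_Ioo_sub_insert (F : Finset ℕ → ℝ) (a b : ℕ) :
    ∑ e ∈ Finset.Ioo a b, (F (Finset.Ioo e b) - F (insert e (Finset.Ioo e b))) =
      F ∅ - F (Finset.Ioo a b) := by
  induction h : b - a generalizing a with
  | zero =>
    have e : Finset.Ioo a b = ∅ := by
      ext x; simp only [Finset.mem_Ioo, Finset.notMem_empty, iff_false]; omega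
    simp [e]
  | succ k ih =>
    rcases Nat.eq_zero_or_pos k with hk | hk
    · have e : Finset.Ioo a b = ∅ := by
        ext x; simp only [Finset.mem_Ioo, Finset.notMem_empty, iff_false]; omega
      simp [e]
    · have e : Finset.Ioo a b = insert (a + 1) (Finset.Ioo (a + 1) b) := by
        ext x; simp only [Finset.mem_Ioo, Finset.mem_insert]; omega
      rw [e, Finset.sum_insert (by simp), ih (a + 1) (by omega)]
      ring

/-- The quadruples `1 ≤ a < b < c < d ≤ n`. -/
def quads (n : ℕ) : Finset (ℕ × ℕ × ℕ × ℕ) :=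
  (Finset.Icc 1 n ×ˢ Finset.Icc 1 n ×ˢ Finset.Icc 1 n ×ˢ Finset.Icc 1 n).filter
    fun q => q.1 < q.2.1 ∧ q.2.1 < q.2.2.1 ∧ q.2.2.1 < q.2.2.2

lemma mem_quads {n a b c d : ℕ} :
    (a, b, c, d) ∈ quads n ↔ 1 ≤ a ∧ a < b ∧ b < c ∧ c < d ∧ d ≤ n := by
  simp only [quads, Finset.mem_filter, Finset.mem_product, Finset.mem_Icc]
  omega

lemma mem_tetra {n a b c : ℕ} :
    (a, b, c) ∈ tetra n ↔ 1 ≤ a ∧ a < b ∧ b < c ∧ c ≤ n := by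
  simp only [tetra, Finset.mem_filter, Finset.mem_product, Finset.mem_Icc]
  omega

/-! ### Triples with an extra point in one of the four gaps, reindexed as quadruples. -/

lemma sum_tetra_sum_Ioo_right (n : ℕ) (g : ℕ → ℕ → ℕ → ℕ → ℝ) :
    ∑ t ∈ tetra n, ∑ e ∈ Finset.Ioo t.2.2 (n + 1), g t.1 t.2.1 t.2.2 e =
      ∑ q ∈ quads n, g q.1 q.2.1 q.2.2.1 q.2.2.2 := by
  rw [Finset.sum_sigma']
  refine Finset.sum_nbij' (fun x => (x.1.1, x.1.2.1, x.1.2.2, x.2))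
    (fun q => ⟨(q.1, q.2.1, q.2.2.1), q.2.2.2⟩) ?_ ?_ ?_ ?_ ?_
  · rintro ⟨⟨a, b, c⟩, e⟩ h
    simp only [Finset.mem_sigma, mem_tetra, mem_quads, Finset.mem_Ioo] at h ⊢
    omega
  · rintro ⟨a, b, c, d⟩ h
    simp only [Finset.mem_sigma, mem_tetra, mem_quads, Finset.mem_Ioo] at h ⊢
    omega
  all_goals intros; rfl

lemma sum_tetra_sum_Ioo_midright (n : ℕ) (g : ℕ → ℕ → ℕ → ℕ → ℝ) :
    ∑ t ∈ tetra n, ∑ e ∈ Finset.Ioo t.2.1 t.2.2, g t.1 t.2.1 t.2.2 e =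
      ∑ q ∈ quads n, g q.1 q.2.1 q.2.2.2 q.2.2.1 := by
  rw [Finset.sum_sigma']
  refine Finset.sum_nbij' (fun x => (x.1.1, x.1.2.1, x.2, x.1.2.2))
    (fun q => ⟨(q.1, q.2.1, q.2.2.2), q.2.2.1⟩) ?_ ?_ ?_ ?_ ?_
  · rintro ⟨⟨a, b, c⟩, e⟩ h
    simp only [Finset.mem_sigma, mem_tetra, mem_quads, Finset.mem_Ioo] at h ⊢
    omega
  · rintro ⟨a, b, c, d⟩ h
    simp only [Finset.mem_sigma, mem_tetra, mem_quads, Finset.mem_Ioo] at h ⊢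
    omega
  all_goals intros; rfl

lemma sum_tetra_sum_Ioo_midleft (n : ℕ) (g : ℕ → ℕ → ℕ → ℕ → ℝ) :
    ∑ t ∈ tetra n, ∑ e ∈ Finset.Ioo t.1 t.2.1, g t.1 t.2.1 t.2.2 e =
      ∑ q ∈ quads n, g q.1 q.2.2.1 q.2.2.2 q.2.1 := by
  rw [Finset.sum_sigma']
  refine Finset.sum_nbij' (fun x => (x.1.1, x.2, x.1.2.1, x.1.2.2))
    (fun q => ⟨(q.1, q.2.2.1, q.2.2.2), q.2.1⟩) ?_ ?_ ?_ ?_ ?_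
  · rintro ⟨⟨a, b, c⟩, e⟩ h
    simp only [Finset.mem_sigma, mem_tetra, mem_quads, Finset.mem_Ioo] at h ⊢
    omega
  · rintro ⟨a, b, c, d⟩ h
    simp only [Finset.mem_sigma, mem_tetra, mem_quads, Finset.mem_Ioo] at h ⊢
    omega
  all_goals intros; rfl

lemma sum_tetra_sum_Ioo_left (n : ℕ) (g : ℕ → ℕ → ℕ → ℕ → ℝ) :
    ∑ t ∈ tetra n, ∑ e ∈ Finset.Ioo 0 t.1, g t.1 t.2.1 t.2.2 e =
      ∑ q ∈ quads n, g q.2.1 q.2.2.1 q.2.2.2 q.1 := by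
  rw [Finset.sum_sigma']
  refine Finset.sum_nbij' (fun x => (x.2, x.1.1, x.1.2.1, x.1.2.2))
    (fun q => ⟨(q.2.1, q.2.2.1, q.2.2.2), q.1⟩) ?_ ?_ ?_ ?_ ?_
  · rintro ⟨⟨a, b, c⟩, e⟩ h
    simp only [Finset.mem_sigma, mem_tetra, mem_quads, Finset.mem_Ioo] at h ⊢
    omega
  · rintro ⟨a, b, c, d⟩ h
    simp only [Finset.mem_sigma, mem_tetra, mem_quads, Finset.mem_Ioo] at h ⊢
    omega
  all_goals intros; rfl

open Finset in
/-- Summing the eight-term relation over all quadruples. -/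
lemma sum_tetra_eq_of_eight_term (n : ℕ) (f : ℕ → ℕ → ℕ → Finset ℕ → ℝ)
    (h : ∀ {K : Finset ℕ} {a b c d : ℕ}, 1 ≤ a → a < b → b < c → c < d → d ≤ n →
      a ∉ K → b ∉ K → c ∉ K → d ∉ K →
      f a b c (insert d K) - f a b c K + (f a b d K - f a b d (insert c K)) +
        (f a c d (insert b K) - f a c d K) + (f b c d K - f b c d (insert a K)) = 0) :
    ∑ t ∈ tetra n, f t.1 t.2.1 t.2.2 (Ioo t.1 t.2.1 ∪ Ioo t.2.2 (n + 1)) =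
      ∑ t ∈ tetra n, f t.1 t.2.1 t.2.2 (Ioo 0 t.1 ∪ Ioo t.2.1 t.2.2) := by
  rw [← sub_eq_zero, ← sum_sub_distrib]
  -- The increments are kept opaque for the reindexing rewrites. They follow the path (a,b) ∪ (c,n]
  -- → (a,b) → (a,b) ∪ (b,c) → (b,c) → [1,a) ∪ (b,c), one element at a time.
  obtain ⟨g1, hg1⟩ : ∃ g : ℕ → ℕ → ℕ → ℕ → ℝ, g = fun a b c e =>
      f a b c (insert e (Ioo a b ∪ Ioo c e)) -
        f a b c (Ioo a b ∪ Ioo c e) := ⟨_, rfl⟩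
  obtain ⟨g2, hg2⟩ : ∃ g : ℕ → ℕ → ℕ → ℕ → ℝ, g = fun a b c e =>
      f a b c (Ioo a b ∪ Ioo e c) -
        f a b c (insert e (Ioo a b ∪ Ioo e c)) := ⟨_, rfl⟩
  obtain ⟨g3, hg3⟩ : ∃ g : ℕ → ℕ → ℕ → ℕ → ℝ, g = fun a b c e =>
      f a b c (insert e (Ioo a e ∪ Ioo b c)) -
        f a b c (Ioo a e ∪ Ioo b c) := ⟨_, rfl⟩
  obtain ⟨g4, hg4⟩ : ∃ g : ℕ → ℕ → ℕ → ℕ → ℝ, g = fun a b c e =>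
      f a b c (Ioo e a ∪ Ioo b c) -
        f a b c (insert e (Ioo e a ∪ Ioo b c)) := ⟨_, rfl⟩
  have split : ∀ t ∈ tetra n, f t.1 t.2.1 t.2.2 (Ioo t.1 t.2.1 ∪ Ioo t.2.2 (n + 1)) -
      f t.1 t.2.1 t.2.2 (Ioo 0 t.1 ∪ Ioo t.2.1 t.2.2) =
      ∑ e ∈ Ioo t.2.2 (n + 1), g1 t.1 t.2.1 t.2.2 e +
      ∑ e ∈ Ioo t.2.1 t.2.2, g2 t.1 t.2.1 t.2.2 e +
      ∑ e ∈ Ioo t.1 t.2.1, g3 t.1 t.2.1 t.2.2 e +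
      ∑ e ∈ Ioo 0 t.1, g4 t.1 t.2.1 t.2.2 e := by
    rintro ⟨a, b, c⟩ -
    have e1 := sum_Ioo_insert_sub (fun S => f a b c (Ioo a b ∪ S)) c (n + 1)
    have e2 := sum_Ioo_sub_insert (fun S => f a b c (Ioo a b ∪ S)) b c
    have e3 := sum_Ioo_insert_sub (fun S => f a b c (S ∪ Ioo b c)) a b
    have e4 := sum_Ioo_sub_insert (fun S => f a b c (S ∪ Ioo b c)) 0 a
    simp only [union_insert, insert_union] at e1 e2 e3 e4
    simp only [hg1, hg2, hg3, hg4, e1, e2, e3, e4]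
    ring
  rw [sum_congr rfl split, sum_add_distrib, sum_add_distrib, sum_add_distrib,
    sum_tetra_sum_Ioo_right n g1, sum_tetra_sum_Ioo_midright n g2, sum_tetra_sum_Ioo_midleft n g3,
    sum_tetra_sum_Ioo_left n g4, ← sum_add_distrib, ← sum_add_distrib, ← sum_add_distrib]
  refine sum_eq_zero ?_
  rintro ⟨a, b, c, d⟩ hq
  obtain ⟨h1, h2, h3, h4, h5⟩ := mem_quads.1 hq
  simp only [hg1, hg2, hg3, hg4]
  -- After reindexing, all four increments have the same base set (a,b) ∪ (c,d).
  refine h h1 h2 h3 h4 h5 ?_ ?_ ?_ ?_ <;> simp only [mem_union, mem_Ioo] <;> omega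

lemma sum_ell_exchangeRatio_eq {n : ℕ} {p : Finset ℕ → ℝ} (hp : PositivePlucker n p) :
    ∑ t ∈ tetra n, ell (exchangeRatio p t.1 t.2.1 t.2.2
        (Finset.Ioo t.1 t.2.1 ∪ Finset.Ioo t.2.2 (n + 1))) =
      ∑ t ∈ tetra n, ell (exchangeRatio p t.1 t.2.1 t.2.2
        (Finset.Ioo 0 t.1 ∪ Finset.Ioo t.2.1 t.2.2)) :=
  sum_tetra_eq_of_eight_term n (fun a b c K => ell (exchangeRatio p a b c K))
    (ell_exchangeRatio_eight_term hp)

lemma card_tetra (n : ℕ) : ((tetra n).card : ℝ) = n * ((n : ℝ) - 1) * ((n : ℝ) - 2) / 6 := by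
  have h1 : (tetra n).card =
      ((Finset.range n).sigma fun c => (Finset.range c).sigma fun b => Finset.range b).card := by
    refine Finset.card_nbij' (fun t => ⟨t.2.2 - 1, t.2.1 - 1, t.1 - 1⟩)
      (fun x => (x.2.2 + 1, x.2.1 + 1, x.1 + 1)) ?_ ?_ ?_ ?_
    · rintro ⟨a, b, c⟩ h
      simp only [Finset.mem_coe, Finset.mem_sigma, mem_tetra, Finset.mem_range] at h ⊢
      omega
    · rintro ⟨c, b, a⟩ h
      simp only [Finset.mem_coe, Finset.mem_sigma, mem_tetra, Finset.mem_range] at h ⊢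
      omega
    · rintro ⟨a, b, c⟩ h
      simp only [Finset.mem_coe, mem_tetra] at h
      simp only [Prod.mk.injEq]
      omega
    · rintro ⟨c, b, a⟩ _
      simp
  rw [h1]
  simp only [Finset.card_sigma, Finset.card_range]
  push_cast
  have h2 : ∀ c : ℕ, ∑ b ∈ Finset.range c, (b : ℝ) = c * ((c : ℝ) - 1) / 2 := by
    intro c
    induction c with
    | zero => simp
    | succ c ih => rw [Finset.sum_range_succ, ih]; push_cast; ring
  simp only [h2]
  clear h1
  induction n with
  | zero => simp
  | succ n ih =>
    rw [Finset.sum_range_succ, ih]; push_cast; ring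

end TotPos

namespace TotPos

open Matrix

variable {n : ℕ}

/-! ### Flag minors of totally positive matrices -/

lemma val_le_val_of_strictMono {k : ℕ} {c : Fin k → Fin n} (hc : StrictMono c) (i : Fin k) :
    (i : ℕ) ≤ c i := by
  obtain ⟨m, hm⟩ := i
  induction m with
  | zero => exact Nat.zero_le _
  | succ m ih =>
    have h1 := ih (by omega)
    have h2 : c ⟨m, by omega⟩ < c ⟨m + 1, hm⟩ := hc (by simp [Fin.lt_def])
    simp only [Fin.lt_def] at h1 h2 ⊢
    omega

lemma val_le_lastEmb_of_strictMono {k : ℕ} (hk : k ≤ n) {r : Fin k → Fin n} (hr : StrictMono r)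
    (i : Fin k) : r i ≤ lastEmb hk i := by
  have h := val_le_val_of_strictMono (c := fun i => (r i.rev).rev)
    (fun a b hab => Fin.rev_lt_rev.2 (hr (Fin.rev_lt_rev.2 hab))) i.rev
  simp only [Fin.rev_rev, Fin.val_rev] at h
  change ((r i : Fin n) : ℕ) ≤ n - k + i
  omega

/-- A minor with `r i ≤ c i` for all `i` does not vanish identically on unipotent matrices. -/
lemma exists_isUnipotentUpper_minor_ne_zero {k : ℕ} {r c : Fin k ↪o Fin n} (h : ∀ i, r i ≤ c i) :
    ∃ G : Matrix (Fin n) (Fin n) ℝ, IsUnipotentUpper G ∧ minor G r c ≠ 0 := by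
  classical
  -- Ones are added to the identity at the positions (r l, c l). The chosen submatrix is then lower
  -- triangular with unit diagonal, because r i = c j with i < j would contradict r i ≤ c i.
  refine ⟨of fun i j => if i = j ∨ ∃ l, r l = i ∧ c l = j then 1 else 0, ⟨?_, ?_⟩, ?_⟩
  · intro i
    simp
  · intro i j hji
    rw [of_apply, if_neg]
    rintro (rfl | ⟨l, rfl, rfl⟩)
    · exact lt_irrefl _ hji
    · exact absurd (h l) (not_le.2 hji)
  · rw [minor, det_of_isLowerTriangular]
    · rw [Finset.prod_eq_one]
      · exact one_ne_zero
      · intro i _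
        rw [submatrix_apply, of_apply, if_pos (Or.inr ⟨i, rfl, rfl⟩)]
    · intro i j hij
      have hij : i < j := hij
      rw [submatrix_apply, of_apply, if_neg]
      rintro (h1 | ⟨l, h1, h2⟩)
      · exact absurd (c.le_iff_le.1 (h1 ▸ h i)) (not_le.2 hij)
      · exact hij.ne ((r.injective h1).symm.trans (c.injective h2))

lemma IsTotallyPositive.minor_pos {M : Matrix (Fin n) (Fin n) ℝ} (hM : IsTotallyPositive M)
    {k : ℕ} {r c : Fin k ↪o Fin n} (h : ∀ i, r i ≤ c i) : 0 < minor M r c :=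
  hM.2 k r c (exists_isUnipotentUpper_minor_ne_zero h)

lemma IsTotallyPositive.rightFlag_pos {M : Matrix (Fin n) (Fin n) ℝ} (hM : IsTotallyPositive M)
    (I : Finset (Fin n)) : 0 < rightFlag M I :=
  hM.minor_pos fun i => val_le_lastEmb_of_strictMono _ (I.orderEmbOfFin rfl).strictMono i

lemma IsTotallyPositive.upperFlag_pos {M : Matrix (Fin n) (Fin n) ℝ} (hM : IsTotallyPositive M)
    (J : Finset (Fin n)) : 0 < upperFlag M J :=
  hM.minor_pos fun i => val_le_val_of_strictMono (J.orderEmbOfFin rfl).strictMono i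

/-- The sign of the reversal of `k` elements. -/
def revSign (k : ℕ) : ℝ := ((Equiv.Perm.sign (Fin.revPerm : Equiv.Perm (Fin k)) : ℤ) : ℝ)

lemma revSign_mul_self (k : ℕ) : revSign k * revSign k = 1 := by
  rcases Int.units_eq_one_or (Equiv.Perm.sign (Fin.revPerm : Equiv.Perm (Fin k))) with h | h <;>
    simp [revSign, h]

/-- The rows of `M`, read from right to left. -/
def rightRows (M : Matrix (Fin n) (Fin n) ℝ) (i : Fin n) (j : ℕ) : ℝ :=
  if h : j < n then M i (Fin.rev ⟨j, h⟩) else 0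

/-- The columns of `M`, read from top to bottom. -/
def upperRows (M : Matrix (Fin n) (Fin n) ℝ) (i : Fin n) (j : ℕ) : ℝ :=
  if h : j < n then M ⟨j, h⟩ i else 0

lemma rowDet_rightRows (M : Matrix (Fin n) (Fin n) ℝ) {k : ℕ} (hk : k ≤ n) (r : Fin k → Fin n) :
    rowDet (rightRows M) r = revSign k * (M.submatrix r (lastEmb hk)).det := by
  rw [revSign, ← det_permute', rowDet]
  congr 1
  ext i j
  have hj : (j : ℕ) < n := by omega
  simp only [of_apply, rightRows, hj, dif_pos, submatrix_apply, id]
  congr 1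
  ext
  change n - ((j : ℕ) + 1) = n - k + ((Fin.rev j : Fin k) : ℕ)
  rw [Fin.val_rev]
  omega

lemma rightFlag_eq (M : Matrix (Fin n) (Fin n) ℝ) (I : Finset (Fin n)) :
    rightFlag M I = revSign I.card * flagMinor (rightRows M) I := by
  rw [flagMinor, rowDet_rightRows M (card_finset_fin_le I), ← mul_assoc, revSign_mul_self,
    one_mul]
  rfl

lemma upperFlag_eq (M : Matrix (Fin n) (Fin n) ℝ) (J : Finset (Fin n)) :
    upperFlag M J = flagMinor (upperRows M) J := by
  rw [flagMinor, rowDet, ← det_transpose]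
  unfold upperFlag minor
  congr 1
  ext i j
  have hi : (i : ℕ) < n := by have := card_finset_fin_le J; omega
  simp only [transpose_apply, of_apply, upperRows, hi, dif_pos, submatrix_apply]
  rfl

lemma flagMinor_image_rev (v : Fin n → ℕ → ℝ) (I : Finset (Fin n)) :
    flagMinor v (I.image Fin.rev) = revSign I.card * flagMinor (fun i => v i.rev) I := by
  have hcard : (I.image Fin.rev).card = I.card := Finset.card_image_of_injective _ Fin.rev_injective
  have huniq : (fun i => (I.orderEmbOfFin rfl i.rev).rev) =
      (I.image Fin.rev).orderEmbOfFin hcard := by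
    refine Finset.orderEmbOfFin_unique hcard (fun i => ?_) fun a b hab =>
      Fin.rev_lt_rev.2 ((I.orderEmbOfFin rfl).strictMono (Fin.rev_lt_rev.2 hab))
    exact Finset.mem_image_of_mem _ (I.orderEmbOfFin_mem rfl _)
  rw [flagMinor_eq v _ hcard, ← huniq, revSign, flagMinor, ← rowDet_comp_perm]
  rfl

/-- Right multiplication by an upper triangular matrix mixes each column only with earlier ones, so
leading-column minors scale by the leading minor of U, whatever the rows. -/
lemma rowDet_mul_upper {ι : Type*} {v w : ι → ℕ → ℝ} {U : ℕ → ℕ → ℝ}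
    (hv : ∀ i j, j < n → v i j = ∑ l ∈ Finset.range n, w i l * U l j)
    (hU : ∀ l j, j < l → U l j = 0) {m : ℕ} (hm : m ≤ n) (r : Fin m → ι) :
    rowDet v r = det (of fun i j : Fin m => U i j) * rowDet w r := by
  rw [mul_comm, rowDet, rowDet, ← det_mul]
  congr 1
  ext i j
  rw [of_apply, hv _ _ (by omega), mul_apply, ← Finset.sum_subset (Finset.range_mono hm),
    Finset.sum_range]
  · rfl
  · intro l _ hl
    rw [hU l j (by simp only [Finset.mem_range] at hl; omega), mul_zero]

lemma flagMinor_image_rev_eq {v w : Fin n → ℕ → ℝ} {U : ℕ → ℕ → ℝ}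
    (hv : ∀ i j, j < n → v i.rev j = ∑ l ∈ Finset.range n, w i l * U l j)
    (hU : ∀ l j, j < l → U l j = 0) (I : Finset (Fin n)) :
    flagMinor v (I.image Fin.rev) =
      revSign I.card * det (of fun i j : Fin I.card => U i j) * flagMinor w I := by
  rw [flagMinor_image_rev, flagMinor, rowDet_mul_upper hv hU (card_finset_fin_le I), mul_assoc]
  rfl

/-! ### The Gauss decomposition -/

lemma revMatrix_apply (i j : Fin n) : revMatrix n i j = if j = i.rev then 1 else 0 := by
  rw [revMatrix, of_apply]
  congr 1
  rw [Fin.ext_iff, Fin.val_rev]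
  exact propext (by omega)

lemma mul_revMatrix_apply (A : Matrix (Fin n) (Fin n) ℝ) (i j : Fin n) :
    (A * revMatrix n) i j = A i j.rev := by
  rw [mul_apply, Finset.sum_eq_single j.rev]
  · simp [revMatrix_apply]
  · intro l _ hl
    rw [revMatrix_apply, if_neg, mul_zero]
    rintro rfl
    exact hl (Fin.rev_rev l).symm
  · simp

lemma revMatrix_mul_apply (A : Matrix (Fin n) (Fin n) ℝ) (i j : Fin n) :
    (revMatrix n * A) i j = A i.rev j := by
  simp [mul_apply, revMatrix_apply]

lemma IsGauss.apply {M M' M'' : Matrix (Fin n) (Fin n) ℝ} {d : Fin n → ℝ}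
    (h : IsGauss M M' M'' d) (i j : Fin n) :
    M i.rev j.rev = ∑ l, M' i l.rev * d l * M'' l j := by
  have e := congrFun (congrFun h.2.2 i) j
  rw [mul_revMatrix_apply, revMatrix_mul_apply, mul_apply] at e
  rw [e]
  refine Finset.sum_congr rfl fun l _ => ?_
  rw [mul_diagonal, mul_revMatrix_apply]

/-- Read from right to left, the rows of M at reversed indices are the rows of M' multiplied by the
upper triangular matrix D M''. -/
lemma IsGauss.rightFlag_image_rev {M M' M'' : Matrix (Fin n) (Fin n) ℝ} {d : Fin n → ℝ}
    (h : IsGauss M M' M'' d) :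
    ∃ κ : ℕ → ℝ, ∀ I, rightFlag M (I.image Fin.rev) = κ I.card * rightFlag M' I := by
  set U : ℕ → ℕ → ℝ := fun l j =>
    if hl : l < n then if hj : j < n then d ⟨l, hl⟩ * M'' ⟨l, hl⟩ ⟨j, hj⟩ else 0 else 0 with hU
  refine ⟨fun k => revSign k * det (of fun i j : Fin k => U i j), fun I => ?_⟩
  rw [rightFlag_eq, rightFlag_eq, flagMinor_image_rev_eq (w := rightRows M') (U := U),
    Finset.card_image_of_injective _ Fin.rev_injective]
  · ring
  · intro i j hj
    rw [rightRows, dif_pos hj, h.apply, Finset.sum_range]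
    refine Finset.sum_congr rfl fun l _ => ?_
    simp only [hU, rightRows, l.2, hj, dif_pos, Fin.eta, mul_assoc]
  · intro l j hlj
    simp only [hU]
    split_ifs
    · rw [h.2.1.2 _ _ (by simpa [Fin.lt_def] using hlj), mul_zero]
    all_goals rfl

/-- On columns, the triangular factor is the transpose of P M' P D. -/
lemma IsGauss.upperFlag_image_rev {M M' M'' : Matrix (Fin n) (Fin n) ℝ} {d : Fin n → ℝ}
    (h : IsGauss M M' M'' d) :
    ∃ κ : ℕ → ℝ, ∀ J, upperFlag M (J.image Fin.rev) = κ J.card * upperFlag M'' J := by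
  set U : ℕ → ℕ → ℝ := fun l j =>
    if hl : l < n then if hj : j < n then
      M' (Fin.rev ⟨j, hj⟩) (Fin.rev ⟨l, hl⟩) * d ⟨l, hl⟩ else 0 else 0 with hU
  refine ⟨fun k => revSign k * det (of fun i j : Fin k => U i j), fun J => ?_⟩
  rw [upperFlag_eq, upperFlag_eq, flagMinor_image_rev_eq (w := upperRows M'') (U := U)]
  · intro i j hj
    have e := h.apply (Fin.rev ⟨j, hj⟩) i
    rw [Fin.rev_rev] at e
    rw [upperRows, dif_pos hj, e, Finset.sum_range]
    refine Finset.sum_congr rfl fun l _ => ?_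
    simp only [hU, upperRows, l.2, hj, dif_pos, Fin.eta]
    ring
  · intro l j hlj
    simp only [hU]
    split_ifs
    · rw [h.1.2 _ _ (Fin.rev_lt_rev.2 (by simpa [Fin.lt_def] using hlj)), zero_mul]
    all_goals rfl

/-- The `LDU` decomposition of a matrix with nonvanishing leading principal minors. -/
lemma exists_eq_lower_mul_diagonal_mul_upper (A : Matrix (Fin n) (Fin n) ℝ)
    (hA : ∀ k (hk : k ≤ n), (A.submatrix (Fin.castLE hk) (Fin.castLE hk)).det ≠ 0) :
    ∃ (L U : Matrix (Fin n) (Fin n) ℝ) (d : Fin n → ℝ),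
      IsUnipotentUpper Lᵀ ∧ IsUnipotentUpper U ∧ A = L * diagonal d * U := by
  induction n with
  | zero => exact ⟨1, 1, 0, ⟨fun i => i.elim0, fun i => i.elim0⟩,
      ⟨fun i => i.elim0, fun i => i.elim0⟩, by ext i; exact i.elim0⟩
  | succ n ih =>
    obtain ⟨L, U, d, hL, hU, h⟩ := ih (A.submatrix Fin.castSucc Fin.castSucc)
      fun k hk => hA k (hk.trans n.le_succ)
    have hdet : (L * diagonal d * U).det ≠ 0 := by
      rw [← h]
      exact hA n n.le_succ
    rw [det_mul] at hdet
    have hLd : IsUnit (L * diagonal d).det := (left_ne_zero_of_mul hdet).isUnit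
    have hdU : IsUnit (diagonal d * U).det := by
      rw [det_mul] at hdet ⊢
      exact (mul_ne_zero (right_ne_zero_of_mul (left_ne_zero_of_mul hdet))
        (right_ne_zero_of_mul hdet)).isUnit
    -- Bordering: y is the new column of U, x the new row of L, and the new diagonal entry is the
    -- Schur complement, which need not be nonzero.
    set y : Fin n → ℝ := (L * diagonal d)⁻¹ *ᵥ fun i => A i.castSucc (Fin.last n) with hy
    set x : Fin n → ℝ := (fun j => A (Fin.last n) j.castSucc) ᵥ* (diagonal d * U)⁻¹ with hx
    have hy' : ∀ i, ∑ l, L i l * d l * y l = A i.castSucc (Fin.last n) := by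
      intro i
      have : ((L * diagonal d) *ᵥ y) i = A i.castSucc (Fin.last n) := by
        rw [hy, mulVec_mulVec, mul_nonsing_inv _ hLd, one_mulVec]
      simpa [mulVec, dotProduct] using this
    have hx' : ∀ j, ∑ l, x l * d l * U l j = A (Fin.last n) j.castSucc := by
      intro j
      have : (x ᵥ* (diagonal d * U)) j = A (Fin.last n) j.castSucc := by
        rw [hx, vecMul_vecMul, nonsing_inv_mul _ hdU, vecMul_one]
      simpa [vecMul, dotProduct, mul_assoc] using this
    have h' : ∀ i j, ∑ l, L i l * d l * U l j = A i.castSucc j.castSucc := by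
      intro i j
      have := congrFun (congrFun h i) j
      rw [submatrix_apply, mul_apply] at this
      simpa using this.symm
    refine ⟨of fun i j => Fin.lastCases (motive := fun _ => ℝ)
        (Fin.lastCases (motive := fun _ => ℝ) 1 x j)
        (fun i => Fin.lastCases (motive := fun _ => ℝ) 0 (L i) j) i,
      of fun i j => Fin.lastCases (motive := fun _ => ℝ)
        (Fin.lastCases (motive := fun _ => ℝ) 1 (fun _ => 0) j)
        (fun i => Fin.lastCases (motive := fun _ => ℝ) (y i) (U i) j) i,
      Fin.lastCases (motive := fun _ => ℝ)
        (A (Fin.last n) (Fin.last n) - ∑ l, x l * d l * y l) d, ⟨?_, ?_⟩, ⟨?_, ?_⟩, ?_⟩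
    · intro i
      refine Fin.lastCases ?_ (fun i => ?_) i
      · simp
      · simpa using hL.1 i
    · intro i j
      refine Fin.lastCases ?_ (fun i => ?_) i <;> refine Fin.lastCases ?_ (fun j => ?_) j
      · simp
      · simp
      · intro hlt
        exact absurd hlt (not_lt.2 (Fin.le_last _))
      · intro hlt
        simpa using hL.2 i j (Fin.castSucc_lt_castSucc_iff.1 hlt)
    · intro i
      refine Fin.lastCases ?_ (fun i => ?_) i
      · simp
      · simpa using hU.1 i
    · intro i j
      refine Fin.lastCases ?_ (fun i => ?_) i <;> refine Fin.lastCases ?_ (fun j => ?_) j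
      · simp
      · simp
      · intro hlt
        exact absurd hlt (not_lt.2 (Fin.le_last _))
      · intro hlt
        simpa using hU.2 i j (Fin.castSucc_lt_castSucc_iff.1 hlt)
    · ext i j
      rw [mul_apply]
      simp only [mul_diagonal, of_apply, Fin.sum_univ_castSucc, Fin.lastCases_last,
        Fin.lastCases_castSucc]
      refine Fin.lastCases ?_ (fun i => ?_) i <;> refine Fin.lastCases ?_ (fun j => ?_) j <;>
        simp [hx', hy', h']

lemma IsTotallyPositive.exists_isGauss {M : Matrix (Fin n) (Fin n) ℝ}
    (hM : IsTotallyPositive M) :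
    ∃ p : Matrix (Fin n) (Fin n) ℝ × Matrix (Fin n) (Fin n) ℝ, ∃ d, IsGauss M p.1 p.2 d := by
  -- Up to sign, the leading principal minors of M P are right flag minors of M. With M P = L D U,
  -- the required M' is P L P.
  obtain ⟨L, U, d, hL, hU, h⟩ :=
    exists_eq_lower_mul_diagonal_mul_upper (M * revMatrix n) fun k hk => by
      have e := rowDet_rightRows M hk (firstEmb hk)
      have hpos := hM.minor_pos (r := firstEmb hk) (c := lastEmb hk) fun i =>
        val_le_lastEmb_of_strictMono hk (firstEmb hk).strictMono i
      have hs : revSign k ≠ 0 := left_ne_zero_of_mul_eq_one (revSign_mul_self k)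
      have e' : ((M * revMatrix n).submatrix (Fin.castLE hk) (Fin.castLE hk)).det =
          rowDet (rightRows M) (firstEmb hk) := by
        rw [rowDet]
        congr 1
        ext i j
        have hj : (j : ℕ) < n := by omega
        rw [submatrix_apply, mul_revMatrix_apply, of_apply, rightRows, dif_pos hj]
        rfl
      rw [e', e]
      exact mul_ne_zero hs hpos.ne'
  refine ⟨(revMatrix n * L * revMatrix n, U), d, ⟨fun i => ?_, fun i j hji => ?_⟩, hU, ?_⟩
  · change (revMatrix n * L * revMatrix n) i i = 1
    rw [mul_revMatrix_apply, revMatrix_mul_apply]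
    exact hL.1 _
  · change (revMatrix n * L * revMatrix n) i j = 0
    rw [mul_revMatrix_apply, revMatrix_mul_apply]
    exact hL.2 _ _ (Fin.rev_lt_rev.2 hji)
  · have hP : revMatrix n * revMatrix n = 1 := by
      ext i j
      rw [mul_revMatrix_apply, revMatrix_apply, one_apply]
      simp [Fin.rev_inj, eq_comm]
    calc revMatrix n * M * revMatrix n = revMatrix n * (L * diagonal d * U) := by
          rw [← h, Matrix.mul_assoc]
      _ = revMatrix n * L * (revMatrix n * revMatrix n) * diagonal d * U := by
          rw [hP, Matrix.mul_one]
          simp only [Matrix.mul_assoc]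
      _ = _ := by simp only [Matrix.mul_assoc]

/-- Existence is all that is needed: the argument works for whichever decomposition was chosen,
without uniqueness. -/
lemma IsTotallyPositive.isGauss_prime_dprime {M : Matrix (Fin n) (Fin n) ℝ}
    (hM : IsTotallyPositive M) : ∃ d, IsGauss M (prime M) (dprime M) d := by
  have h := hM.exists_isGauss
  rw [prime, dprime, gaussPair, dif_pos h]
  exact h.choose_spec

end TotPos

namespace TotPos

variable {n : ℕ}

/-! ### Label sets -/

/-- The elements of `Fin n` whose label lies in `S`. -/
def labelled (n : ℕ) (S : Finset ℕ) : Finset (Fin n) :=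
  Finset.univ.filter fun i => (i : ℕ) + 1 ∈ S

lemma mem_labelled {S : Finset ℕ} {i : Fin n} : i ∈ labelled n S ↔ (i : ℕ) + 1 ∈ S := by
  simp [labelled]

lemma mem_seg {a b : ℕ} {i : Fin n} : i ∈ seg n a b ↔ a ≤ (i : ℕ) + 1 ∧ (i : ℕ) + 1 ≤ b := by
  simp [seg]

lemma mem_image_rev {I : Finset (Fin n)} {i : Fin n} : i ∈ I.image Fin.rev ↔ i.rev ∈ I := by
  constructor
  · rintro h
    obtain ⟨j, hj, rfl⟩ := Finset.mem_image.1 h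
    rwa [Fin.rev_rev]
  · exact fun h => Finset.mem_image.2 ⟨_, h, Fin.rev_rev i⟩

lemma labelled_insert {S : Finset ℕ} {a : ℕ} (h1 : 1 ≤ a) (hn : a ≤ n) :
    labelled n (insert a S) = insert ⟨a - 1, by omega⟩ (labelled n S) := by
  ext i
  simp only [mem_labelled, Finset.mem_insert, Fin.ext_iff]
  have : (i : ℕ) + 1 = a ↔ (i : ℕ) = a - 1 := by omega
  rw [this]

lemma card_labelled_insert {S : Finset ℕ} {a : ℕ} (h1 : 1 ≤ a) (hn : a ≤ n) (ha : a ∉ S) :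
    (labelled n (insert a S)).card = (labelled n S).card + 1 := by
  rw [labelled_insert h1 hn, Finset.card_insert_of_notMem]
  rw [mem_labelled]
  simpa [Nat.sub_add_cancel h1] using ha

/-- Labels outside 1, …, n are ignored by `labelled`, so positivity extends to all finite sets of
naturals. -/
lemma positivePlucker_labelled {p : Finset (Fin n) → ℝ} (hpos : ∀ I, 0 < p I)
    (h : ∀ {K : Finset (Fin n)} {a b c : Fin n}, a < b → b < c → a ∉ K → b ∉ K → c ∉ K →
      p (insert b K) * p (insert a (insert c K)) =
        p (insert a K) * p (insert b (insert c K)) + p (insert a (insert b K)) * p (insert c K)) :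
    PositivePlucker n fun S => p (labelled n S) where
  pos S := hpos _
  three_term := by
    intro K a b c ha hab hbc hc haK hbK hcK
    have hb : 1 ≤ b := by omega
    have hc1 : 1 ≤ c := by omega
    have han : a ≤ n := by omega
    have hbn : b ≤ n := by omega
    have nin : ∀ {x : ℕ} (hx : 1 ≤ x) (hxn : x ≤ n), x ∉ K →
        (⟨x - 1, by omega⟩ : Fin n) ∉ labelled n K := by
      intro x hx hxn hxK
      rw [mem_labelled]
      simpa [Nat.sub_add_cancel hx] using hxK
    simp only [labelled_insert ha han, labelled_insert hb hbn, labelled_insert hc1 hc]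
    refine h ?_ ?_ (nin ha han haK) (nin hb hbn hbK) (nin hc1 hc hcK) <;>
      simp only [Fin.lt_def] <;> omega

lemma positivePlucker_rightFlag {M : Matrix (Fin n) (Fin n) ℝ} (hM : IsTotallyPositive M) :
    PositivePlucker n fun S => rightFlag M (labelled n S) := by
  refine positivePlucker_labelled hM.rightFlag_pos fun {K a b c} hab hbc ha hb hc => ?_
  have c1 : ∀ {x : Fin n}, x ∉ K → (insert x K).card = K.card + 1 := fun hx =>
    Finset.card_insert_of_notMem hx
  have c2 : ∀ {x y : Fin n}, x < y → x ∉ K → y ∉ K →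
      (insert x (insert y K)).card = K.card + 2 := fun hxy hx hy => by
    rw [Finset.card_insert_of_notMem (by simp [hxy.ne, hx]), c1 hy]
  simp only [rightFlag_eq, c1 ha, c1 hb, c1 hc, c2 hab ha hb, c2 hbc hb hc,
    c2 (hab.trans hbc) ha hc]
  linear_combination revSign (K.card + 1) * revSign (K.card + 2) *
    flagMinor_plucker_three (rightRows M) hab hbc ha hb hc

lemma positivePlucker_upperFlag {M : Matrix (Fin n) (Fin n) ℝ} (hM : IsTotallyPositive M) :
    PositivePlucker n fun S => upperFlag M (labelled n S) := by
  refine positivePlucker_labelled hM.upperFlag_pos fun hab hbc ha hb hc => ?_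
  simp only [upperFlag_eq]
  exact flagMinor_plucker_three (upperRows M) hab hbc ha hb hc

/-! ### The dilogarithm identity -/

/-- The cross ratio underlying both `Ylow` and `Yup`. -/
noncomputable def crossRatio (p : Finset (Fin n) → ℝ) (a b c : ℕ) : ℝ :=
  (p (seg n a (b - 1) ∪ seg n (c + 1) n) * p (seg n (a + 1) b ∪ seg n c n)) /
    (p (seg n a b ∪ seg n (c + 1) n) * p (seg n (a + 1) (b - 1) ∪ seg n c n))

lemma Ylow_eq (a b c : ℕ) (M : Matrix (Fin n) (Fin n) ℝ) :
    Ylow a b c M = crossRatio (rightFlag M) a b c := rfl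

lemma Yup_eq (a b c : ℕ) (M : Matrix (Fin n) (Fin n) ℝ) :
    Yup a b c M = (crossRatio (upperFlag M) a b c)⁻¹ := by
  rw [crossRatio, inv_div]
  rfl

lemma crossRatio_eq_exchangeRatio (p : Finset (Fin n) → ℝ) {a b c : ℕ} (hab : a < b)
    (hc : c ≤ n) :
    crossRatio p a b c = exchangeRatio (fun S => p (labelled n S)) a b c
      (Finset.Ioo a b ∪ Finset.Ioo c (n + 1)) := by
  unfold crossRatio exchangeRatio
  congr 3 <;> ext i <;>
    simp only [Finset.mem_union, mem_seg, mem_labelled, Finset.mem_insert, Finset.mem_Ioo] <;>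
    omega

/-- The map x ↦ n + 1 - x carries the four label sets of the reversed triple to cK, abK, bcK and aK,
with K = [1,a) ∪ (b,c). -/
lemma crossRatio_rev_eq_inv_exchangeRatio {p p' : Finset (Fin n) → ℝ} {κ : ℕ → ℝ}
    (hp : ∀ I, 0 < p I) (hκ : ∀ I, p (I.image Fin.rev) = κ I.card * p' I) {a b c : ℕ}
    (ha : 1 ≤ a) (hab : a < b) (hbc : b < c) (hc : c ≤ n) :
    crossRatio p' (n + 1 - c) (n + 1 - b) (n + 1 - a) =
      (exchangeRatio (fun S => p (labelled n S)) a b c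
        (Finset.Ioo 0 a ∪ Finset.Ioo b c))⁻¹ := by
  set K := Finset.Ioo 0 a ∪ Finset.Ioo b c with hK
  have hκ0 : ∀ I : Finset (Fin n), κ I.card ≠ 0 := fun I => left_ne_zero_of_mul (hκ I ▸ (hp _).ne')
  have hp' : ∀ (I : Finset (Fin n)) (S : Finset ℕ), I.image Fin.rev = labelled n S →
      p' I = (κ (labelled n S).card)⁻¹ * p (labelled n S) := by
    intro I S hS
    have e : (labelled n S).card = I.card := by
      rw [← hS, Finset.card_image_of_injective _ Fin.rev_injective]
    rw [e, ← hS, hκ, inv_mul_cancel_left₀ (hκ0 I)]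
  have haK : a ∉ K := by simp only [hK, Finset.mem_union, Finset.mem_Ioo]; omega
  have hbK : b ∉ K := by simp only [hK, Finset.mem_union, Finset.mem_Ioo]; omega
  have hcK : c ∉ K := by simp only [hK, Finset.mem_union, Finset.mem_Ioo]; omega
  have haK' : a ∉ insert b K := by simp [hab.ne, haK]
  have hbK' : b ∉ insert c K := by simp [hbc.ne, hbK]
  rw [crossRatio, exchangeRatio, inv_div,
    hp' _ (insert c K), hp' _ (insert a (insert b K)), hp' _ (insert b (insert c K)),
    hp' _ (insert a K), card_labelled_insert (by omega) (by omega) haK',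
    card_labelled_insert (by omega) (by omega) hbK',
    card_labelled_insert (by omega) (by omega) haK, card_labelled_insert (by omega) (by omega) hbK,
    card_labelled_insert (by omega) (by omega) hcK]
  -- Numerator and denominator each contain one set of size |K| + 1 and one of size |K| + 2, so the
  -- factors κ cancel.
  · have k1 : κ ((labelled n K).card + 1) ≠ 0 := by
      rw [← card_labelled_insert (by omega) (by omega) haK]
      exact hκ0 _
    have k2 : κ ((labelled n K).card + 1 + 1) ≠ 0 := by
      rw [← card_labelled_insert (by omega) (by omega) hbK,
        ← card_labelled_insert (by omega) (by omega) haK']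
      exact hκ0 _
    have h1 := (hp (labelled n (insert a K))).ne'
    have h2 := (hp (labelled n (insert b (insert c K)))).ne'
    field_simp
  all_goals
    ext i
    simp only [mem_image_rev, Finset.mem_union, mem_seg, mem_labelled, Finset.mem_insert,
      Finset.mem_Ioo, Fin.val_rev, hK]
    omega

lemma sum_tetra_rev (g : ℕ → ℕ → ℕ → ℝ) :
    ∑ t ∈ tetra n, g t.1 t.2.1 t.2.2 =
      ∑ t ∈ tetra n, g (n + 1 - t.2.2) (n + 1 - t.2.1) (n + 1 - t.1) := by
  refine Finset.sum_nbij' (fun t => (n + 1 - t.2.2, n + 1 - t.2.1, n + 1 - t.1))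
    (fun t => (n + 1 - t.2.2, n + 1 - t.2.1, n + 1 - t.1)) ?_ ?_ ?_ ?_ ?_
  · rintro ⟨a, b, c⟩ h
    simp only [mem_tetra] at h ⊢
    omega
  · rintro ⟨a, b, c⟩ h
    simp only [mem_tetra] at h ⊢
    omega
  · rintro ⟨a, b, c⟩ h
    simp only [mem_tetra, Prod.mk.injEq] at h ⊢
    omega
  · rintro ⟨a, b, c⟩ h
    simp only [mem_tetra, Prod.mk.injEq] at h ⊢
    omega
  · rintro ⟨a, b, c⟩ h
    simp only [mem_tetra] at h ⊢
    congr 1 <;> omega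

/-- With x and y the exchange ratios at the two base sets, Σ l(x) = Σ l(y) and l(z) + l(1/z) = 1
give both Σ l(x) + Σ l(1/y) and Σ l(1/x) + Σ l(y). The inverted form serves `Yup`. -/
lemma sum_ell_crossRatio_add {p p' : Finset (Fin n) → ℝ} {κ : ℕ → ℝ}
    (hp : PositivePlucker n fun S => p (labelled n S)) (hpos : ∀ I, 0 < p I)
    (hκ : ∀ I, p (I.image Fin.rev) = κ I.card * p' I) :
    (∑ t ∈ tetra n, ell (crossRatio p t.1 t.2.1 t.2.2)) +
        ∑ t ∈ tetra n, ell (crossRatio p' t.1 t.2.1 t.2.2) =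
      (n : ℝ) * ((n : ℝ) - 1) * ((n : ℝ) - 2) / 6 ∧
    (∑ t ∈ tetra n, ell (crossRatio p t.1 t.2.1 t.2.2)⁻¹) +
        ∑ t ∈ tetra n, ell (crossRatio p' t.1 t.2.1 t.2.2)⁻¹ =
      (n : ℝ) * ((n : ℝ) - 1) * ((n : ℝ) - 2) / 6 := by
  have key := sum_ell_exchangeRatio_eq hp
  rw [sum_tetra_rev fun a b c => ell (crossRatio p' a b c),
    sum_tetra_rev fun a b c => ell (crossRatio p' a b c)⁻¹, ← card_tetra]
  set x : ℕ × ℕ × ℕ → ℝ := fun t => exchangeRatio (fun S => p (labelled n S)) t.1 t.2.1 t.2.2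
    (Finset.Ioo t.1 t.2.1 ∪ Finset.Ioo t.2.2 (n + 1)) with hx
  set y : ℕ × ℕ × ℕ → ℝ := fun t => exchangeRatio (fun S => p (labelled n S)) t.1 t.2.1 t.2.2
    (Finset.Ioo 0 t.1 ∪ Finset.Ioo t.2.1 t.2.2) with hy
  have ex : ∀ t ∈ tetra n, crossRatio p t.1 t.2.1 t.2.2 = x t := by
    rintro ⟨a, b, c⟩ ht
    obtain ⟨-, h2, -, h4⟩ := mem_tetra.1 ht
    exact crossRatio_eq_exchangeRatio p h2 h4
  have ey : ∀ t ∈ tetra n,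
      crossRatio p' (n + 1 - t.2.2) (n + 1 - t.2.1) (n + 1 - t.1) = (y t)⁻¹ := by
    rintro ⟨a, b, c⟩ ht
    obtain ⟨h1, h2, h3, h4⟩ := mem_tetra.1 ht
    exact crossRatio_rev_eq_inv_exchangeRatio hpos hκ h1 h2 h3 h4
  have inv_sum : ∀ z : ℕ × ℕ × ℕ → ℝ, (∀ t, 0 < z t) →
      ∑ t ∈ tetra n, ell (z t) + ∑ t ∈ tetra n, ell (z t)⁻¹ = (tetra n).card := by
    intro z hz
    rw [← Finset.sum_add_distrib, Finset.sum_congr rfl fun t _ => ell_add_ell_inv (hz t)]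
    simp
  have hsx := inv_sum x fun t => exchangeRatio_pos hp _ _ _ _
  have hsy := inv_sum y fun t => exchangeRatio_pos hp _ _ _ _
  rw [Finset.sum_congr rfl fun t ht => congrArg ell (ex t ht),
    Finset.sum_congr rfl fun t ht => congrArg ell (ey t ht),
    Finset.sum_congr rfl fun t ht => congrArg (fun z => ell z⁻¹) (ex t ht),
    Finset.sum_congr rfl fun t ht => congrArg (fun z => ell z⁻¹) (ey t ht)]
  simp only [inv_inv]
  constructor <;> linarith

end TotPos

theorem proposition3p6 (n : ℕ) (M : Matrix (Fin n) (Fin n) ℝ)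
    (hM : TotPos.IsTotallyPositive M) :
    ((∑ t ∈ TotPos.tetra n, TotPos.ell (TotPos.Ylow t.1 t.2.1 t.2.2 M)) +
        ∑ t ∈ TotPos.tetra n, TotPos.ell (TotPos.Ylow t.1 t.2.1 t.2.2 (TotPos.prime M)) =
      (n : ℝ) * ((n : ℝ) - 1) * ((n : ℝ) - 2) / 6) ∧
    ((∑ t ∈ TotPos.tetra n, TotPos.ell (TotPos.Yup t.1 t.2.1 t.2.2 M)) +
        ∑ t ∈ TotPos.tetra n, TotPos.ell (TotPos.Yup t.1 t.2.1 t.2.2 (TotPos.dprime M)) =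
      (n : ℝ) * ((n : ℝ) - 1) * ((n : ℝ) - 2) / 6) := by
  obtain ⟨d, hd⟩ := hM.isGauss_prime_dprime
  obtain ⟨κ, hκ⟩ := hd.rightFlag_image_rev
  obtain ⟨μ, hμ⟩ := hd.upperFlag_image_rev
  simp only [TotPos.Ylow_eq, TotPos.Yup_eq]
  exact ⟨(TotPos.sum_ell_crossRatio_add (TotPos.positivePlucker_rightFlag hM)
      hM.rightFlag_pos hκ).1,
    (TotPos.sum_ell_crossRatio_add (TotPos.positivePlucker_upperFlag hM) hM.upperFlag_pos hμ).2⟩
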